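/- Throughout, algebras and their homomorphisms are unital and associative, and $[x,y]=xy-yx$. Let $\Re$ (the universal Racah algebra) be the $\mathbb C$-algebra with generators $A,B,C,\Delta$ and the relations $[A,B]=[B,C]=[C,A]=2\Delta$ together with the requirement that each of $$[A,\Delta]+AC-BA,\qquad [B,\Delta]+BA-CB,\qquad [C,\Delta]+CB-AC$$ is central in $\Re$. Let $D\ge 2$ be an integer and let $X$ be the power set of a $D$-element set. The hypercube $H(D,2)$ is the graph with vertex set $X$ in which $x,y$ are adjacent if and only if one of them covers the other with respect to inclusion; let $R_2$ be the set of pairs $(x,y)$ at distance $2$ in $H(D,2)$. On the complex vector space $\mathbb C^X$ with basis $X$ define linear operators by $$\mathbf A_2^J x=\sum_{\substack{|y|=|x|\\ (x,y)\in R_2}}y,\qquad \mathbf A_2^{\bar J}x=\sum_{\substack{|y|\ne|x|\\ (x,y)\in R_2}}y,\qquad \mathbf A_2^* x=\frac{(D-2|x|)^2-D}{2}\,x\qquad(x\in X),$$ and let $\mathbf R$ be the subalgebra of $\operatorname{End}(\mathbb C^X)$ generated by $\mathbf A_2^J,\mathbf A_2^{\bar J},\mathbf A_2^*$. A square matrix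 is irreducible tridiagonal if all its nonzero entries lie on the diagonal, subdiagonal or superdiagonal, and all entries on the subdiagonal and superdiagonal are nonzero. Linear operators $L,L^*,L^\varepsilon$ on a vector space $V$ of finite positive dimension form a Leonard triple if for each one of the three there is a basis of $V$ with respect to which that operator is represented by a diagonal matrix and the other two by irreducible tridiagonal matrices. **Theorem 1.8.** (i) There exists a unique algebra homomorphism $\Re\to\mathbf R$ that sends $$A\mapsto \frac D{16}-\frac14+\frac{\mathbf A_2^J+\mathbf A_2^{\bar J}}8,\qquad B\mapsto \frac D{16}-\frac14+\frac{\mathbf A_2^*}8,\qquad C\mapsto \frac D{16}-\frac14+\frac{\mathbf A_2^J-\mathbf A_2^{\bar J}}8.$$ Moreover, this algebra homomorphism is surjective. (ii) $\mathbf A_2^J+\mathbf A_2^{\bar J}$, $\mathbf A_2^*$, $\mathbf A_2^J-\mathbf A_2^{\bar J}$ act on each irreducible $\mathbf R$-module as a Leonard triple. -/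

import Mathlib

noncomputable section

namespace HypercubeRacah

/-! ### The universal Racah algebra -/

/-- The four generators of the universal Racah algebra. -/
inductive RacahGen : Type
  | A | B | C | Δ

/-- A generator, as an element of the free algebra. -/
abbrev gen (g : RacahGen) : FreeAlgebra ℂ RacahGen := FreeAlgebra.ι ℂ g

/-- The element `[A, Δ] + A C - B A` of the free algebra. -/
def preAlpha : FreeAlgebra ℂ RacahGen :=
  (gen .A * gen .Δ - gen .Δ * gen .A) + gen .A * gen .C - gen .B * gen .A

/-- The element `[B, Δ] + B A - C B` of the free algebra. -/
def preBeta : FreeAlgebra ℂ RacahGen :=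
  (gen .B * gen .Δ - gen .Δ * gen .B) + gen .B * gen .A - gen .C * gen .B

/-- The element `[C, Δ] + C B - A C` of the free algebra. -/
def preGamma : FreeAlgebra ℂ RacahGen :=
  (gen .C * gen .Δ - gen .Δ * gen .C) + gen .C * gen .B - gen .A * gen .C

/-- The defining relations: `[A,B] = [B,C] = [C,A] = 2Δ`, and the three elements above are
central. -/
inductive RacahRel : FreeAlgebra ℂ RacahGen → FreeAlgebra ℂ RacahGen → Prop
  | comm_AB : RacahRel (gen .A * gen .B - gen .B * gen .A) (2 * gen .Δ)
  | comm_BC : RacahRel (gen .B * gen .C - gen .C * gen .B) (2 * gen .Δ)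
  | comm_CA : RacahRel (gen .C * gen .A - gen .A * gen .C) (2 * gen .Δ)
  | central_alpha (x : FreeAlgebra ℂ RacahGen) : RacahRel (preAlpha * x) (x * preAlpha)
  | central_beta (x : FreeAlgebra ℂ RacahGen) : RacahRel (preBeta * x) (x * preBeta)
  | central_gamma (x : FreeAlgebra ℂ RacahGen) : RacahRel (preGamma * x) (x * preGamma)

/-- The universal Racah algebra `ℜ`. -/
abbrev Racah : Type := RingQuot RacahRel

/-- The image of a generator in the universal Racah algebra. -/
def Racah.of (g : RacahGen) : Racah := RingQuot.mkAlgHom ℂ RacahRel (gen g)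

/-! ### Leonard triples -/

/-- A square matrix is irreducible tridiagonal: all entries off the diagonal, subdiagonal and
superdiagonal vanish, and all entries on the subdiagonal and superdiagonal are nonzero. -/
def IsIrredTridiagonal {n : ℕ} (M : Matrix (Fin n) (Fin n) ℂ) : Prop :=
  (∀ i j : Fin n, M i j ≠ 0 → (i : ℕ) ≤ j + 1 ∧ (j : ℕ) ≤ i + 1) ∧
  (∀ i j : Fin n, (i : ℕ) + 1 = j → M i j ≠ 0 ∧ M j i ≠ 0)

/-- In some ordered basis of the (`n`-dimensional) space `V`, the operator `K` is diagonal and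
`L`, `M` are irreducible tridiagonal. -/
def DiagTridiagTridiag {V : Type*} [AddCommGroup V] [Module ℂ V] (n : ℕ)
    (K L M : V →ₗ[ℂ] V) : Prop :=
  ∃ b : Module.Basis (Fin n) ℂ V,
    (LinearMap.toMatrix b b K).IsDiag ∧
    IsIrredTridiagonal (LinearMap.toMatrix b b L) ∧
    IsIrredTridiagonal (LinearMap.toMatrix b b M)

/-- Leonard triples of linear operators on a complex vector space of finite positive dimension. -/
def IsLeonardTriple {V : Type*} [AddCommGroup V] [Module ℂ V] (L L' L'' : V →ₗ[ℂ] V) : Prop :=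
  ∃ n : ℕ, 0 < n ∧
    DiagTridiagTridiag n L L' L'' ∧
    DiagTridiagTridiag n L' L'' L ∧
    DiagTridiagTridiag n L'' L L'

/-! ### The hypercube and its operators -/

/-- The hypercube on the power set of `S`: two vertices are adjacent iff one covers the other
with respect to inclusion. -/
def hypercube (S : Type*) : SimpleGraph (Finset S) := SimpleGraph.hasse (Finset S)

variable (S : Type*) [Fintype S] [DecidableEq S]

/-- The operator `A₂^J` on `ℂ^X`, the space with basis `X`, the power set of `S` (the vector `x`
being `Pi.single x 1`): a subset `x` is
sent to the sum of the subsets at distance two from `x` of the same size. -/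
def opJ : Module.End ℂ (Finset S → ℂ) :=
  (Pi.basisFun ℂ (Finset S)).constr ℂ fun x : Finset S =>
    ∑ y : Finset S with y.card = x.card ∧ (hypercube S).dist x y = 2, Pi.single y (1 : ℂ)

/-- The operator `A₂^{J̄}`: a subset `x` is sent to the sum of the subsets at distance two from
`x` of a size different from that of `x`. -/
def opJbar : Module.End ℂ (Finset S → ℂ) :=
  (Pi.basisFun ℂ (Finset S)).constr ℂ fun x : Finset S =>
    ∑ y : Finset S with y.card ≠ x.card ∧ (hypercube S).dist x y = 2, Pi.single y (1 : ℂ)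

/-- The second dual distance operator `A₂^*` with respect to the empty set. -/
def opStar : Module.End ℂ (Finset S → ℂ) :=
  (Pi.basisFun ℂ (Finset S)).constr ℂ fun x : Finset S =>
    ((((Fintype.card S : ℂ) - 2 * (x.card : ℂ)) ^ 2 - (Fintype.card S : ℂ)) / 2) •
      Pi.single x (1 : ℂ)

/-- The subalgebra `𝐑` of `End(ℂ^X)` generated by `A₂^J`, `A₂^{J̄}`, `A₂^*`. -/
def algR : Subalgebra ℂ (Module.End ℂ (Finset S → ℂ)) :=
  Algebra.adjoin ℂ {opJ S, opJbar S, opStar S}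

/-- `A₂^J` as an element of `𝐑`. -/
def genJ : algR S := ⟨opJ S, Algebra.subset_adjoin (by simp)⟩

/-- `A₂^{J̄}` as an element of `𝐑`. -/
def genJbar : algR S := ⟨opJbar S, Algebra.subset_adjoin (by simp)⟩

/-- `A₂^*` as an element of `𝐑`. -/
def genStar : algR S := ⟨opStar S, Algebra.subset_adjoin (by simp)⟩

/-- The algebra homomorphism `φ : ℜ → 𝐑` has the prescribed values at `A`, `B`, `C`. -/
def HasPrescribedValues (φ : Racah →ₐ[ℂ] algR S) : Prop :=
  φ (Racah.of .A) = algebraMap ℂ (algR S) ((Fintype.card S : ℂ) / 16 - 1 / 4)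
      + (1 / 8 : ℂ) • (genJ S + genJbar S) ∧
  φ (Racah.of .B) = algebraMap ℂ (algR S) ((Fintype.card S : ℂ) / 16 - 1 / 4)
      + (1 / 8 : ℂ) • genStar S ∧
  φ (Racah.of .C) = algebraMap ℂ (algR S) ((Fintype.card S : ℂ) / 16 - 1 / 4)
      + (1 / 8 : ℂ) • (genJ S - genJbar S)

end HypercubeRacah

end

/-! View the space as the `D`-fold tensor power of `ℂ²`, one factor per element of `S`. The sums
`totalX`, `totalY`, `totalZ` of Pauli operators over the factors satisfy, after scaling by `1/(2i)`,
the relations of `𝔰𝔬₃`. Their squares are `D + 2(J + J̄)`, `D + 2(J - J̄)` and `D + 2A₂^*`, so the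
prescribed images of `A`, `B`, `C` are `(T² - 4)/16` for `T = totalX, totalZ, totalY`. The Racah
relations become identities between squares in an `𝔰𝔬₃`-triple (`comm_sq`, `double_comm_sq`), and
the three central elements go to `0`.

For (ii), `A + B + C` commutes with everything, hence is a scalar `δ` on an irreducible module, and
eliminating `C` leaves two quadratic relations between `A` and `B`. Each `T` is a sum of commuting
involutions, so `A`, `B`, `C` are diagonalizable with eigenvalues `θ(h) = (h² - 4)/16`, `h` an
integer. On a `B`-eigenvector for `θ(h)`, one relation confines `A v` to the eigenvalues `θ(h)`,
`θ(h ± 4)`; the other forces the downward component along a chain to be a multiple of the previous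
vector (`chain_step`). A chain begun at a minimal index therefore spans an invariant subspace, so it
is a basis. A vanishing lowering coefficient would produce a proper invariant subspace, so `A` is
irreducible tridiagonal, and so is `C = δ - A - B`. Cyclic symmetry gives the other two bases. -/

namespace HypercubeRacah

/-! ### Identities between squares in an `𝔰𝔬₃`-triple -/

section Rotation

variable {E : Type*} [Ring E]

/-- Three elements satisfying the commutation relations of `𝔰𝔬₃`. -/
structure IsRotationTriple (x y z : E) : Prop where
  comm_xy : x * y - y * x = z
  comm_yz : y * z - z * y = x
  comm_zx : z * x - x * z = y

namespace IsRotationTriple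

variable {x y z : E}

lemma cycle (h : IsRotationTriple x y z) : IsRotationTriple y z x :=
  ⟨h.comm_yz, h.comm_zx, h.comm_xy⟩

lemma yx (h : IsRotationTriple x y z) : y * x = x * y - z := by rw [← h.comm_xy]; abel
lemma zy (h : IsRotationTriple x y z) : z * y = y * z - x := by rw [← h.comm_yz]; abel
lemma zx (h : IsRotationTriple x y z) : z * x = x * z + y := by rw [← h.comm_zx]; abel

lemma yx_assoc (h : IsRotationTriple x y z) (t : E) : y * (x * t) = x * (y * t) - z * t := by
  rw [← mul_assoc, h.yx, sub_mul, mul_assoc]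
lemma zx_assoc (h : IsRotationTriple x y z) (t : E) : z * (x * t) = x * (z * t) + y * t := by
  rw [← mul_assoc, h.zx, add_mul, mul_assoc]

lemma commute_casimir (h : IsRotationTriple x y z) :
    (x * x + y * y + z * z) * x = x * (x * x + y * y + z * z) := by
  simp only [mul_assoc, mul_add, add_mul, mul_sub, h.yx, h.zx, h.yx_assoc, h.zx_assoc]
  abel

lemma commute_casimir_sq (h : IsRotationTriple x y z) :
    Commute (x * x + y * y + z * z) (x * x) :=
  Commute.mul_right h.commute_casimir h.commute_casimir

/-- The Casimir element commutes with `y²`; cancel `y⁴`. -/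
lemma comm_sq (h : IsRotationTriple x y z) :
    x * x * (y * y) - y * y * (x * x) = y * y * (z * z) - z * z * (y * y) := by
  have := h.cycle.commute_casimir_sq.eq
  simp only [add_mul, mul_add] at this
  rw [sub_eq_sub_iff_add_eq_add]
  have h2 : x * x * (y * y) + z * z * (y * y) + y * y * (y * y)
      = y * y * (z * z) + y * y * (x * x) + y * y * (y * y) := by
    convert this using 1 <;> abel
  exact add_right_cancel h2

/-- Both sides agree once monomials are put in the order `x`, `y`, `z`. The shifts by `1` absorb the
lower-order terms and become the constant `4` in `(T² - 4)/16`. -/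
lemma double_comm_sq (h : IsRotationTriple x y z) :
    x * x * (x * x * (y * y) - y * y * (x * x)) - (x * x * (y * y) - y * y * (x * x)) * (x * x)
      = -8 * ((y * y + 1) * (x * x + 1) - (x * x + 1) * (z * z + 1)) := by
  simp only [mul_assoc, mul_add, add_mul, mul_sub, sub_mul, h.yx, h.zy, h.zx, h.yx_assoc,
    h.zx_assoc, neg_mul, one_mul, mul_one]
  have (t : E) : 8 * t = (8 : ℕ) • t := by simp
  simp only [this]
  abel

end IsRotationTriple

end Rotation

section Sum

variable {E : Type*} [Ring E]

lemma commutator_sum {ι : Type*} [Fintype ι] [DecidableEq ι] {x y z : ι → E}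
    (h : ∀ i, x i * y i - y i * x i = z i) (hc : ∀ i j, i ≠ j → Commute (x i) (y j)) :
    (∑ i, x i) * (∑ i, y i) - (∑ i, y i) * (∑ i, x i) = ∑ i, z i := by
  rw [Finset.sum_mul_sum, Finset.sum_mul_sum, Finset.sum_comm (f := fun i j => y i * x j),
    ← Finset.sum_sub_distrib]
  refine Finset.sum_congr rfl fun i _ => ?_
  rw [← Finset.sum_sub_distrib, Finset.sum_eq_single i]
  · exact h i
  · intro j _ hj
    rw [(hc i j hj.symm).eq, sub_self]
  · simp

end Sum

/-! ### Diagonalizability and its transfer to modules -/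

section Involution

open Module.End

variable {W : Type*} [AddCommGroup W] [Module ℂ W]

/-- An eigenvector of `s` splits into `σ = ±1` parts, on which the eigenvalue shifts by `±1`. -/
lemma iSup_eigenspace_add_involution {s σ : Module.End ℂ W}
    (hs : ⨆ h : ℤ, eigenspace s (h : ℂ) = ⊤) (hσ : σ * σ = 1) (hc : Commute s σ) :
    ⨆ h : ℤ, eigenspace (s + σ) (h : ℂ) = ⊤ := by
  rw [eq_top_iff, ← hs]
  refine iSup_le fun h w hw => ?_
  rw [mem_eigenspace_iff] at hw
  have hσσ (w : W) : σ (σ w) = w := by rw [← Module.End.mul_apply, hσ]; rfl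
  have hsσ : s (σ w) = (h : ℂ) • σ w := by
    rw [← Module.End.mul_apply, hc.eq, Module.End.mul_apply, hw, map_smul]
  have hsplit : w = (1 / 2 : ℂ) • (w + σ w) + (1 / 2 : ℂ) • (w - σ w) := by module
  rw [hsplit]
  refine Submodule.add_mem _ (Submodule.smul_mem _ _ ?_) (Submodule.smul_mem _ _ ?_)
  · refine Submodule.mem_iSup_of_mem (h + 1) ?_
    rw [mem_eigenspace_iff]
    simp only [LinearMap.add_apply, map_add, hw, hσσ, hsσ]
    push_cast
    module
  · refine Submodule.mem_iSup_of_mem (h - 1) ?_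
    rw [mem_eigenspace_iff]
    simp only [LinearMap.add_apply, map_sub, hw, hσσ, hsσ]
    push_cast
    module

lemma iSup_eigenspace_sum_involution {ι : Type*} {σ : ι → Module.End ℂ W}
    (hσ : ∀ i, σ i * σ i = 1) (hc : ∀ i j, Commute (σ i) (σ j)) (T : Finset ι) :
    ⨆ h : ℤ, eigenspace (∑ i ∈ T, σ i) (h : ℂ) = ⊤ := by
  classical
  induction T using Finset.induction_on with
  | empty =>
    rw [eq_top_iff]
    refine le_trans ?_ (le_iSup _ 0)
    intro w _
    simp
  | insert i T hi ih =>
    rw [Finset.sum_insert hi, add_comm]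
    exact iSup_eigenspace_add_involution ih (hσ i)
      (Commute.sum_left _ _ _ fun j _ => hc j i)

/-- The eigenvalues of the images of `A`, `B`, `C`. -/
noncomputable def theta (h : ℤ) : ℂ := ((h : ℂ) ^ 2 - 4) / 16

lemma iSup_eigenspace_theta {s t : Module.End ℂ W}
    (hs : ⨆ h : ℤ, eigenspace s (h : ℂ) = ⊤)
    (ht : t = (1 / 16 : ℂ) • (s * s - algebraMap ℂ _ 4)) :
    ⨆ h : ℤ, eigenspace t (theta h) = ⊤ := by
  rw [eq_top_iff, ← hs]
  refine iSup_mono fun h w hw => ?_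
  rw [mem_eigenspace_iff] at hw ⊢
  simp only [ht, LinearMap.smul_apply, LinearMap.sub_apply, Module.End.mul_apply, hw, map_smul,
    Module.algebraMap_end_apply, theta]
  module

-- Diagonalizability is recast as a polynomial identity, which descends to the algebra `𝐑` and from
-- there to all of its modules.
open Polynomial in
lemma exists_prod_X_sub_C_aeval_eq_zero [FiniteDimensional ℂ W] {ι : Type*} {θ : ι → ℂ}
    {t : Module.End ℂ W} (ht : ⨆ i, eigenspace t (θ i) = ⊤) :
    ∃ F : Finset ℂ, (∀ μ ∈ F, μ ∈ Set.range θ) ∧ aeval t (∏ μ ∈ F, (X - C μ)) = 0 := by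
  classical
  have hfin : {μ | HasEigenvalue t μ ∧ μ ∈ Set.range θ}.Finite :=
    Set.Finite.subset (Module.End.finite_hasEigenvalue t) fun μ h => h.1
  refine ⟨hfin.toFinset, fun μ h => ((Set.Finite.mem_toFinset _).1 h).2, ?_⟩
  rw [← LinearMap.ker_eq_top, eq_top_iff, ← ht]
  refine iSup_le fun i w hw => ?_
  rw [LinearMap.mem_ker]
  by_cases h0 : w = 0
  · rw [h0, map_zero]
  have hvec : HasEigenvector t (θ i) w := ⟨hw, h0⟩
  rw [aeval_apply_of_hasEigenvector hvec, eval_prod, Finset.prod_eq_zero (i := θ i), zero_smul]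
  · exact (Set.Finite.mem_toFinset _).2 ⟨hasEigenvalue_of_hasEigenvector hvec, i, rfl⟩
  · simp

open Polynomial in
lemma iSup_eigenspace_of_aeval_eq_zero [FiniteDimensional ℂ W] {ι : Type*} {θ : ι → ℂ}
    {t : Module.End ℂ W} {F : Finset ℂ} (hF : ∀ μ ∈ F, μ ∈ Set.range θ)
    (h0 : aeval t (∏ μ ∈ F, (X - C μ)) = 0) : ⨆ i, eigenspace t (θ i) = ⊤ := by
  have hsq : Squarefree (∏ μ ∈ F, (X - C μ)) :=
    (separable_prod_X_sub_C_iff'.2 fun _ _ _ _ h => h).squarefree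
  rw [eq_top_iff, ← (isSemisimple_of_squarefree_aeval_eq_zero hsq h0).iSup_eigenspace_eq_top]
  refine iSup_le fun μ w hw => ?_
  by_cases hw0 : w = 0
  · rw [hw0]; exact zero_mem _
  have hvec : HasEigenvector t μ w := ⟨hw, hw0⟩
  have := aeval_apply_of_hasEigenvector (p := ∏ μ ∈ F, (X - C μ)) hvec
  rw [h0, LinearMap.zero_apply, eq_comm, smul_eq_zero_iff_left hw0, eval_prod,
    Finset.prod_eq_zero_iff] at this
  obtain ⟨ν, hν, h⟩ := this
  rw [eval_sub, eval_X, eval_C, sub_eq_zero] at h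
  obtain ⟨i, hi⟩ := hF ν hν
  refine Submodule.mem_iSup_of_mem i ?_
  rwa [hi, ← h]

end Involution

end HypercubeRacah

namespace HypercubeRacah

open Module.End

/-! ### Eigenvalue parameters modulo sign -/

section Theta

lemma theta_add_four (h : ℤ) : theta (h + 4) = theta h + (h + 2) / 2 := by
  simp only [theta]; push_cast; ring

lemma theta_neg (h : ℤ) : theta (-h) = theta h := by
  simp [theta]

/-- Representatives of the integers up to sign, closed under adding `4`. -/
def IsChainIndex (h : ℤ) : Prop := (h % 2 = 0 ∧ 0 ≤ h) ∨ h % 4 = 1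

lemma IsChainIndex.add_four_mul {h : ℤ} (hh : IsChainIndex h) (i : ℕ) :
    IsChainIndex (h + 4 * i) := by
  unfold IsChainIndex at *; omega

lemma isChainIndex_or_neg (h : ℤ) : IsChainIndex h ∨ IsChainIndex (-h) := by
  unfold IsChainIndex; omega

/-- Equal values force `h = ±k`. Negation sends the class `1` modulo `4` to `3`, and a nonnegative
even index to a nonpositive one, so the minus sign leaves only `h = k = 0`. -/
lemma theta_injOn {h k : ℤ} (hh : IsChainIndex h) (hk : IsChainIndex k)
    (e : theta h = theta k) : h = k := by
  have e2 : h ^ 2 = k ^ 2 := by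
    have : ((h : ℂ)) ^ 2 = (k : ℂ) ^ 2 := by
      simp only [theta] at e
      linear_combination 16 * e
    exact_mod_cast this
  rcases sq_eq_sq_iff_eq_or_eq_neg.1 e2 with e3 | e3
  · exact e3
  · unfold IsChainIndex at *; omega

end Theta

/-! ### One step of the eigenvector chain, and its starting vector -/

section Chain

variable {V : Type*} [AddCommGroup V] [Module ℂ V]

lemma exists_eigenprojection {ι : Type*} {θ : ι → ℂ} {B : Module.End ℂ V}
    (hB : ⨆ i, eigenspace B (θ i) = ⊤) (μ : ℂ) :
    ∃ π : Module.End ℂ V, (∀ z, B z = μ • z → π z = z) ∧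
      (∀ ν z, ν ≠ μ → B z = ν • z → π z = 0) ∧ ∀ z, π (B z) = μ • π z := by
  have hcompl : IsCompl (eigenspace B μ) (⨆ ν, ⨆ _ : ν ≠ μ, eigenspace B ν) := by
    refine ⟨(eigenspaces_iSupIndep B) μ, ?_⟩
    rw [codisjoint_iff, eq_top_iff, ← hB]
    refine iSup_le fun i => ?_
    by_cases hi : θ i = μ
    · rw [hi]; exact le_sup_left
    · exact le_sup_of_le_right (le_iSup₂_of_le (θ i) hi le_rfl)
  obtain ⟨π, h1, h2⟩ : ∃ π : Module.End ℂ V, (∀ z, B z = μ • z → π z = z) ∧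
      (∀ ν z, ν ≠ μ → B z = ν • z → π z = 0) := by
    refine ⟨(eigenspace B μ).subtype ∘ₗ Submodule.projectionOnto _ _ hcompl, ?_, ?_⟩
    · intro z hz
      have := Submodule.projectionOnto_apply_left hcompl ⟨z, mem_eigenspace_iff.2 hz⟩
      simp only [LinearMap.comp_apply] at this ⊢
      rw [this]; rfl
    · intro ν z hν hz
      have hz' : z ∈ ⨆ ν, ⨆ _ : ν ≠ μ, eigenspace B ν :=
        Submodule.mem_iSup_of_mem ν (Submodule.mem_iSup_of_mem hν (mem_eigenspace_iff.2 hz))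
      have := Submodule.projectionOnto_apply_right hcompl ⟨z, hz'⟩
      simp only [LinearMap.comp_apply] at this ⊢
      rw [this, map_zero]
  refine ⟨π, h1, h2, fun z => ?_⟩
  have hz : z ∈ ⨆ i, eigenspace B (θ i) := hB ▸ Submodule.mem_top
  induction hz using Submodule.iSup_induction' with
  | mem i z hz =>
    rw [mem_eigenspace_iff] at hz
    rw [hz, map_smul]
    by_cases hi : θ i = μ
    · rw [hi]
    · rw [h2 _ z hi hz, smul_zero, smul_zero]
  | zero => simp
  | add x y _ _ hx hy => rw [map_add, map_add, hx, hy, map_add, smul_add]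

/-- The relation `[A, [A, B]] = 2 (A² + A B + B A - δ A)`, evaluated on vectors. -/
def QuadraticRelation (A B : Module.End ℂ V) (δ : ℂ) : Prop :=
  ∀ v, A (A (B v)) - (2 : ℂ) • A (B (A v)) + B (A (A v)) =
    (2 : ℂ) • (A (A v) + A (B v) + B (A v) - δ • A v)

/-- The diagonal coefficient of `A` on the eigenspace of `B` with eigenvalue `theta h`. -/
noncomputable def chainDiag (δ : ℂ) (h : ℤ) : ℂ := (δ - theta h) / 2

/-- The recursion for the lowering coefficients. -/
noncomputable def chainNext (δ : ℂ) (h : ℤ) (a x : ℂ) : ℂ :=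
  ((theta h - 1 - theta (h - 4)) * x - a ^ 2 - 2 * theta h * a + δ * a) /
    (theta (h + 4) - theta h + 1)

variable {A B : Module.End ℂ V} {δ : ℂ}

/-- On an eigenvector the relation is a quadratic polynomial in `B` applied to `A v`, and its roots
are exactly `θ(h ± 4)`. -/
lemma QuadraticRelation.quadratic (hBA : QuadraticRelation B A δ) {h : ℤ} {v : V}
    (hv : B v = theta h • v) :
    B (B (A v)) - (theta (h + 4) + theta (h - 4)) • B (A v)
      + (theta (h + 4) * theta (h - 4)) • A v = (2 * theta h * (theta h - δ)) • v := by
  have := hBA v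
  simp only [hv, map_smul] at this
  have e1 : theta (h + 4) + theta (h - 4) = 2 * theta h + 2 := by
    simp only [theta]; push_cast; ring
  have e2 : theta (h + 4) * theta (h - 4) = theta h ^ 2 - 2 * theta h := by
    simp only [theta]; push_cast; ring
  rw [e1, e2]
  linear_combination (norm := module) this

/-- Removing the diagonal part makes the quadratic homogeneous. Since `(θ(h) - θ(h+4))(θ(h) -
θ(h-4)) = -4θ(h)`, no division is needed and `θ(h) = 0` is allowed. -/
lemma QuadraticRelation.quadratic_sub (hBA : QuadraticRelation B A δ) {h : ℤ} {v : V}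
    (hv : B v = theta h • v) {u : V} (hu : u = A v - chainDiag δ h • v) :
    B (B u - theta (h + 4) • u) = theta (h - 4) • (B u - theta (h + 4) • u) := by
  have e := hBA.quadratic hv
  subst hu
  simp only [map_sub, map_smul, hv]
  have e3 : (theta h - theta (h + 4)) * (theta h - theta (h - 4)) * chainDiag δ h
      = 2 * theta h * (theta h - δ) := by
    simp only [chainDiag, theta]; push_cast; ring
  have e4 := congrArg (· • v) e3
  linear_combination (norm := module) e - e4

/-- The quadratic for `v'` leaves components of `A v'` at `θ(h+8)` and `θ(h)` besides the diagonal
one; the relation for `A`, projected to `θ(h)`, identifies the latter. The conditions on `p` carry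
the factor `x` so that they are void at the start of a chain, where `x = 0`. -/
lemma chain_step (hAB : QuadraticRelation A B δ) (hBA : QuadraticRelation B A δ)
    {h : ℤ} (hh : IsChainIndex h) {p v v' : V} {a x : ℂ} {π : Module.End ℂ V}
    (hv : B v = theta h • v) (hv' : B v' = theta (h + 4) • v')
    (hp : B p = theta (h - 4) • p) (hA : A v = v' + a • v + x • p)
    (hπ : ∀ z, B z = theta h • z → π z = z)
    (hπ0 : ∀ ν z, ν ≠ theta h → B z = ν • z → π z = 0)
    (hπB : ∀ z, π (B z) = theta h • π z) (hπp : x • π p = 0)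
    (hx : x • π (A p) = x • v) {w : V}
    (hw : w = A v' - chainDiag δ (h + 4) • v' - chainNext δ h a x • v) :
    B w = theta (h + 8) • w := by
  have hne {k : ℤ} (hk : IsChainIndex k) (hkh : k ≠ h) : theta k ≠ theta h :=
    fun e => hkh (theta_injOn hk hh e)
  have h4 : theta (h + 4) ≠ theta h := hne (hh.add_four_mul 1) (by omega)
  have h8 : theta (h + 8) ≠ theta h := hne (by simpa using hh.add_four_mul 2) (by omega)
  obtain ⟨u, hu⟩ : ∃ u, u = A v' - chainDiag δ (h + 4) • v' := ⟨_, rfl⟩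
  have hq := hBA.quadratic_sub hv' hu
  rw [show h + 4 + 4 = h + 8 by ring, show h + 4 - 4 = h by ring] at hq
  -- `y` is the `θ(h)`-component of `u`, extracted by Lagrange interpolation in `B`.
  obtain ⟨y, hy⟩ : ∃ y, y = (theta h - theta (h + 8))⁻¹ • (B u - theta (h + 8) • u) := ⟨_, rfl⟩
  have hy1 : (theta h - theta (h + 8)) • y = B u - theta (h + 8) • u := by
    rw [hy, smul_inv_smul₀ (sub_ne_zero.2 h8.symm)]
  have hBy : B y = theta h • y := by
    rw [hy, map_smul, hq, smul_comm]
  have hBw : B (u - y) = theta (h + 8) • (u - y) := by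
    rw [map_sub, hBy]
    linear_combination (norm := module) -hy1
  have hπv' : π v' = 0 := hπ0 _ _ h4 hv'
  have hπAv' : π (A v') = y := by
    have e : A v' = (u - y) + y + chainDiag δ (h + 4) • v' := by rw [hu]; module
    rw [e, map_add, map_add, hπ0 _ _ h8 hBw, hπ _ hBy, map_smul, hπv']
    module
  have hπAv : π (A v) = a • v := by
    rw [hA, map_add, map_add, map_smul, map_smul, hπv', hπ v hv, hπp]
    module
  -- The projected relation is linear in `y`, with all other terms multiples of `v`.
  have key := congrArg π (hAB v)
  have hAAv : π (A (A v)) = y + a ^ 2 • v + x • v := by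
    conv_lhs => rw [hA]
    simp only [map_add, map_smul, hπAv, hπAv', hx]
    module
  have hABAv : π (A (B (A v))) = theta (h + 4) • y + (theta h * a ^ 2) • v
      + (theta (h - 4) * x) • v := by
    conv_lhs => rw [hA]
    simp only [map_add, map_smul, hπAv, hπAv', hv, hv', hp]
    rw [smul_comm x, hx]
    module
  simp only [map_add, map_sub, map_smul, hπB, hv, hAAv, hABAv, hπAv] at key
  -- The denominator is `(h + 4)/2`, and `-4` is not a chain index.
  have hden : theta (h + 4) - theta h + 1 ≠ 0 := by
    rw [theta_add_four]
    intro e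
    have : (h : ℂ) = ((-4 : ℤ) : ℂ) := by push_cast; linear_combination 2 * e
    have : h = -4 := by exact_mod_cast this
    unfold IsChainIndex at hh
    omega
  have hyv : y = chainNext δ h a x • v := by
    have e : (theta (h + 4) - theta h + 1) • y =
        ((theta h - 1 - theta (h - 4)) * x - a ^ 2 - 2 * theta h * a + δ * a) • v := by
      linear_combination (norm := module) (-1 / 2 : ℂ) • key
    rw [chainNext, div_eq_inv_mul, mul_smul, ← e, inv_smul_smul₀ hden]
  have : w = u - y := by rw [hw, hyv, hu]
  rw [this, hBw]

/-- Take the least chain index that occurs, so that nothing lies below it. The indices `0` and `2`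
are special because `h - 4` is then `-(h + 4)` or `-h`, hence gives no new eigenvalue. -/
lemma exists_chain_start [FiniteDimensional ℂ V] [Nontrivial V]
    (hBA : QuadraticRelation B A δ) (hB : ⨆ h : ℤ, eigenspace B (theta h) = ⊤) :
    ∃ h : ℤ, IsChainIndex h ∧ ∃ v : V, v ≠ 0 ∧ ∃ a : ℂ, B v = theta h • v ∧
      B (A v - a • v) = theta (h + 4) • (A v - a • v) := by
  have hinj : Set.InjOn theta {h : ℤ | IsChainIndex h ∧ HasEigenvalue B (theta h)} :=
    fun h hh k hk e => theta_injOn hh.1 hk.1 e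
  have hfin : {h : ℤ | IsChainIndex h ∧ HasEigenvalue B (theta h)}.Finite := by
    refine Set.Finite.of_finite_image (Set.Finite.subset (finite_hasEigenvalue B) ?_) hinj
    rintro _ ⟨h, hh, rfl⟩
    exact hh.2
  have hne : {h : ℤ | IsChainIndex h ∧ HasEigenvalue B (theta h)}.Nonempty := by
    by_contra hcon
    rw [Set.not_nonempty_iff_eq_empty, Set.eq_empty_iff_forall_notMem] at hcon
    have hbot (h : ℤ) : eigenspace B (theta h) = ⊥ := by
      rcases isChainIndex_or_neg h with hh | hh
      · by_contra hb
        exact hcon h ⟨hh, hasEigenvalue_iff.2 hb⟩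
      · by_contra hb
        refine hcon (-h) ⟨hh, hasEigenvalue_iff.2 ?_⟩
        rwa [theta_neg]
    simp only [hbot, iSup_bot] at hB
    exact bot_ne_top hB
  obtain ⟨h, ⟨hh, hev⟩, hmin⟩ := Set.exists_min_image _ id hfin hne
  refine ⟨h, hh, ?_⟩
  obtain ⟨v, hvec⟩ := hev.exists_hasEigenvector
  -- Here `θ(2) = θ(-2) = 0` and `θ(6) = 2`, so `B(B - 2)A` vanishes on `ker B`, and `(1 - B/2)A` is
  -- the compression of `A` to `ker B`. Any eigenvector of it starts a chain; its eigenvalue `a`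
  -- need not be `chainDiag δ 2`.
  by_cases h2 : h = 2
  · subst h2
    have ht2 : theta 2 = 0 := by norm_num [theta]
    have ht6 : theta 6 = 2 := by norm_num [theta]
    have hstab : ∀ z ∈ eigenspace B (theta 2),
        (A - (1 / 2 : ℂ) • (B * A)) z ∈ eigenspace B (theta 2) := by
      intro z hz
      rw [mem_eigenspace_iff] at hz ⊢
      have e := hBA.quadratic hz
      have ht : theta (-2) = 0 := by norm_num [theta]
      norm_num only [ht2, ht6, ht] at e
      simp only [LinearMap.sub_apply, LinearMap.smul_apply, Module.End.mul_apply, map_sub,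
        map_smul, ht2]
      linear_combination (norm := module) (-1 / 2 : ℂ) • e
    have : Nontrivial (eigenspace B (theta 2)) :=
      Submodule.nontrivial_iff_ne_bot.2 (hasEigenvalue_iff.1 hev)
    obtain ⟨a, ha⟩ := exists_eigenvalue ((A - (1 / 2 : ℂ) • (B * A)).restrict hstab)
    obtain ⟨⟨w, hwmem⟩, hw⟩ := ha.exists_hasEigenvector
    refine ⟨w, fun h0 => hw.2 (Subtype.ext h0), a, mem_eigenspace_iff.1 hwmem, ?_⟩
    have hw1 := congrArg Subtype.val hw.apply_eq_smul
    rw [LinearMap.coe_restrict_apply] at hw1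
    simp only [LinearMap.sub_apply, LinearMap.smul_apply, Module.End.mul_apply,
      Submodule.coe_smul] at hw1
    have hBw := mem_eigenspace_iff.1 hwmem
    norm_num only [ht6]
    rw [map_sub, map_smul, hBw, ht2]
    linear_combination (norm := module) (-2 : ℂ) • hw1
  · have hv := hvec.apply_eq_smul
    refine ⟨v, hvec.2, chainDiag δ h, hv, ?_⟩
    have hq := hBA.quadratic_sub hv rfl
    obtain ⟨u, hu⟩ : ∃ u, u = A v - chainDiag δ h • v := ⟨_, rfl⟩
    rw [← hu] at hq ⊢
    rw [← sub_eq_zero]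
    -- Now `θ(-4) = θ(4)`, so `(B - θ(4))² u = 0`; diagonalizability of `B` removes the square.
    by_cases h0 : h = 0
    · subst h0
      obtain ⟨π, hπ, -, hπB⟩ := exists_eigenprojection hB (theta (0 + 4))
      rw [show (0 : ℤ) - 4 = -(0 + 4) by ring, theta_neg] at hq
      rw [← hπ _ hq, map_sub, hπB, map_smul, sub_self]
    -- Otherwise `h - 4` would be a smaller occurring chain index.
    · by_contra hu0
      have hh4 : IsChainIndex (h - 4) := by unfold IsChainIndex at *; omega
      have := hmin (h - 4) ⟨hh4, hasEigenvalue_of_hasEigenvector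
        ⟨mem_eigenspace_iff.2 hq, hu0⟩⟩
      simp only [id] at this
      omega

end Chain

end HypercubeRacah

namespace HypercubeRacah

open Module.End

/-! ### The chain as a basis with tridiagonal action -/

section ChainBasis

variable {V : Type*} [AddCommGroup V] [Module ℂ V]

/-- The sequence obtained from `v` by the three-term recursion with coefficients `a` and `x`. -/
def chainVec (A : Module.End ℂ V) (a x : ℕ → ℂ) (v : V) : ℕ → V
  | 0 => v
  | 1 => A v - a 0 • v
  | i + 2 => A (chainVec A a x v (i + 1)) - a (i + 1) • chainVec A a x v (i + 1)
      - x (i + 1) • chainVec A a x v i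

/-- At `i = 0` the truncated `i - 1` is harmless because `x 0 = 0`. -/
lemma apply_chainVec (A : Module.End ℂ V) (a x : ℕ → ℂ) (hx : x 0 = 0) (v : V) (i : ℕ) :
    A (chainVec A a x v i) = chainVec A a x v (i + 1) + a i • chainVec A a x v i
      + x i • chainVec A a x v (i - 1) := by
  match i with
  | 0 => simp [chainVec, hx]
  | i + 1 => simp only [chainVec, Nat.add_sub_cancel]; module

/-- The lowering coefficients along a chain. -/
noncomputable def chainLower (δ : ℂ) (h : ℤ) (a : ℕ → ℂ) : ℕ → ℂ
  | 0 => 0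
  | i + 1 => chainNext δ (h + 4 * i) (a i) (chainLower δ h a i)

variable {A B : Module.End ℂ V} {δ : ℂ}

/-- Strong induction by `chain_step`. Only `a 0` is left free, to accommodate chains starting at
index `2`. -/
lemma apply_chainVec_eq_smul (hAB : QuadraticRelation A B δ) (hBA : QuadraticRelation B A δ)
    (hB : ⨆ h : ℤ, eigenspace B (theta h) = ⊤) {h : ℤ} (hh : IsChainIndex h) {v : V}
    {a : ℕ → ℂ} (ha : ∀ i, a (i + 1) = chainDiag δ (h + 4 * (i + 1 : ℕ)))
    (hv : B v = theta h • v) (hv1 : B (A v - a 0 • v) = theta (h + 4) • (A v - a 0 • v))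
    (i : ℕ) :
    B (chainVec A a (chainLower δ h a) v i)
      = theta (h + 4 * i) • chainVec A a (chainLower δ h a) v i := by
  set x := chainLower δ h a with hx
  set w := chainVec A a x v with hw
  have hne {i j : ℕ} (hij : i ≠ j) : theta (h + 4 * i) ≠ theta (h + 4 * j) := fun e =>
    hij (by have := theta_injOn (hh.add_four_mul i) (hh.add_four_mul j) e; omega)
  have hx0 : x 0 = 0 := rfl
  have hrec := apply_chainVec A a x hx0 v
  rw [← hw] at hrec
  induction i using Nat.strong_induction_on with
  | _ i ih =>
    match i with
    | 0 => simpa [hw, chainVec] using hv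
    | 1 => simpa [hw, chainVec] using hv1
    | i + 2 =>
      obtain ⟨π, hπ, hπ0, hπB⟩ := exists_eigenprojection hB (theta (h + 4 * i))
      have hi := ih i (by omega)
      have hi1 := ih (i + 1) (by omega)
      rw [show h + 4 * ((i + 1 : ℕ) : ℤ) = h + 4 * i + 4 by push_cast; ring] at hi1
      rw [show h + 4 * ((i + 2 : ℕ) : ℤ) = h + 4 * i + 8 by push_cast; ring]
      have hwi : w (i + 2) = A (w (i + 1)) - chainDiag δ (h + 4 * i + 4) • w (i + 1)
          - chainNext δ (h + 4 * i) (a i) (x i) • w i := by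
        rw [show h + 4 * (i : ℤ) + 4 = h + 4 * ((i + 1 : ℕ) : ℤ) by push_cast; ring, ← ha]
        rfl
      match i with
      | 0 =>
        refine chain_step (p := 0) hAB hBA (hh.add_four_mul 0) hi hi1 (by simp) ?_ hπ hπ0 hπB
          (by simp) (by simp [hx0]) hwi
        rw [hrec 0, hx0]
        module
      | i + 1 =>
        have hp := ih i (by omega)
        refine chain_step (p := w i) hAB hBA (hh.add_four_mul (i + 1)) hi hi1 ?_ (hrec (i + 1))
          hπ hπ0 hπB ?_ ?_ hwi
        · rw [hp]; push_cast; congr 2; ring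
        · rw [hπ0 _ _ (hne (by omega)) hp, smul_zero]
        -- Of the three terms of `A (w i)`, only `w (i + 1)` survives the projection.
        · have hπw (j : ℕ) (hj : j < i + 1) : π (w j) = 0 :=
            hπ0 _ _ (hne (by omega)) (ih j (by omega))
          rw [hrec i, map_add, map_add, map_smul, map_smul, hπ _ hi, hπw i (by omega)]
          match i with
          | 0 => simp [hx0]
          | i + 1 => simp [hπw i (by omega)]

lemma IsIrredTridiagonal.of_eq_neg {n : ℕ} {M N : Matrix (Fin n) (Fin n) ℂ}
    (hM : IsIrredTridiagonal M) (h : ∀ i j, i ≠ j → N i j = -M i j) :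
    IsIrredTridiagonal N := by
  refine ⟨fun i j hij => ?_, fun i j hij => ?_⟩
  · by_cases e : i = j
    · subst e; omega
    · rw [h i j e, neg_ne_zero] at hij
      exact hM.1 i j hij
  · have e : i ≠ j := by rintro rfl; omega
    rw [h i j e, h j i e.symm, neg_ne_zero, neg_ne_zero]
    exact hM.2 i j hij

/-- `U` is the only possible nonzero subspace invariant under `A` and `B`. -/
def IsIrreduciblePair (A B : Module.End ℂ V) : Prop :=
  ∀ U : Submodule ℂ V, (∀ u ∈ U, A u ∈ U) → (∀ u ∈ U, B u ∈ U) → U = ⊥ ∨ U = ⊤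

theorem exists_diag_tridiag_basis [FiniteDimensional ℂ V] [Nontrivial V]
    (hirr : IsIrreduciblePair A B)
    (hAB : QuadraticRelation A B δ) (hBA : QuadraticRelation B A δ)
    (hB : ⨆ h : ℤ, eigenspace B (theta h) = ⊤) :
    ∃ b : Module.Basis (Fin (Module.finrank ℂ V)) ℂ V,
      (LinearMap.toMatrix b b B).IsDiag ∧ IsIrredTridiagonal (LinearMap.toMatrix b b A) := by
  obtain ⟨h, hh, v, hv0, a0, hv, hv1⟩ := exists_chain_start hBA hB
  let a : ℕ → ℂ := fun i => if i = 0 then a0 else chainDiag δ (h + 4 * i)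
  let x := chainLower δ h a
  let w := chainVec A a x v
  have hBw : ∀ i, B (w i) = theta (h + 4 * i) • w i :=
    apply_chainVec_eq_smul hAB hBA hB hh (fun i => by simp [a]) hv (by simpa [a] using hv1)
  have hx0 : x 0 = 0 := rfl
  have hAw : ∀ i, A (w i) = w (i + 1) + a i • w i + x i • w (i - 1) :=
    apply_chainVec A a x hx0 v
  have hinj : Function.Injective fun i : ℕ => theta (h + 4 * i) := fun i j e => by
    have := theta_injOn (hh.add_four_mul i) (hh.add_four_mul j) e; omega
  -- Nonzero chain vectors have distinct eigenvalues, so finite dimension makes the chain stop.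
  have hex : ∃ n, w n = 0 := by
    by_contra! hne
    exact Module.Finite.not_linearIndependent_of_infinite w
      (eigenvectors_linearIndependent' B _ hinj w fun i => ⟨mem_eigenspace_iff.2 (hBw i), hne i⟩)
  classical
  obtain ⟨n, hn, hmin⟩ : ∃ n, w n = 0 ∧ ∀ i < n, w i ≠ 0 :=
    ⟨Nat.find hex, Nat.find_spec hex, fun i hi => Nat.find_min hex hi⟩
  have hn0 : 0 < n := by
    rcases Nat.eq_zero_or_pos n with rfl | hpos
    · exact absurd hn hv0
    · exact hpos
  -- A tail of the chain is invariant as soon as its lowest lowering coefficient vanishes, since `w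
  -- n = 0` closes it at the top. With `j = 0` this shows the chain spans; with `j > 0` it
  -- contradicts independence.
  have hspan (j : ℕ) (hj : j < n) (hxj : x j = 0) :
      Submodule.span ℂ (w '' {k | j ≤ k ∧ k < n}) = ⊤ := by
    have hmem (k : ℕ) (hk : j ≤ k) (hkn : k ≤ n) :
        w k ∈ Submodule.span ℂ (w '' {k | j ≤ k ∧ k < n}) := by
      rcases hkn.eq_or_lt with rfl | hlt
      · rw [hn]; exact zero_mem _
      · exact Submodule.subset_span ⟨k, ⟨hk, hlt⟩, rfl⟩
    have hinv (T : Module.End ℂ V) (hT : ∀ k, j ≤ k → k < n →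
        T (w k) ∈ Submodule.span ℂ (w '' {k | j ≤ k ∧ k < n})) :
        ∀ u ∈ Submodule.span ℂ (w '' {k | j ≤ k ∧ k < n}),
          T u ∈ Submodule.span ℂ (w '' {k | j ≤ k ∧ k < n}) := by
      intro u hu
      suffices hle : Submodule.span ℂ (w '' {k | j ≤ k ∧ k < n}) ≤
          (Submodule.span ℂ (w '' {k | j ≤ k ∧ k < n})).comap T from hle hu
      rw [Submodule.span_le]
      rintro _ ⟨k, ⟨hk, hkn⟩, rfl⟩
      exact hT k hk hkn
    refine (hirr _ (hinv A fun k hk hkn => ?_) (hinv B fun k hk hkn => ?_)).resolve_left ?_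
    · rw [hAw]
      refine add_mem (add_mem (hmem _ (by omega) (by omega))
        (Submodule.smul_mem _ _ (hmem k hk hkn.le))) ?_
      rcases hk.eq_or_lt with rfl | hlt
      · rw [hxj, zero_smul]; exact zero_mem _
      · exact Submodule.smul_mem _ _ (hmem _ (by omega) (by omega))
    · rw [hBw]
      exact Submodule.smul_mem _ _ (hmem k hk hkn.le)
    · intro hbot
      have := hmem j le_rfl hj.le
      rw [hbot, Submodule.mem_bot] at this
      exact hmin j hj this
  have hli : LinearIndependent ℂ fun i : Fin n => w i :=
    eigenvectors_linearIndependent' B (fun i : Fin n => theta (h + 4 * (i : ℕ)))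
      (fun i j e => Fin.ext (hinj e)) _
      fun i => ⟨mem_eigenspace_iff.2 (hBw i), hmin i i.2⟩
  let b : Module.Basis (Fin n) ℂ V := Module.Basis.mk hli (by
    rw [← hspan 0 hn0 hx0]
    refine Submodule.span_mono ?_
    rintro _ ⟨k, ⟨-, hk⟩, rfl⟩
    exact ⟨⟨k, hk⟩, rfl⟩)
  have hb (i : Fin n) : b i = w i := Module.Basis.mk_apply _ _ _
  have hfr : n = Module.finrank ℂ V := by
    rw [Module.finrank_eq_card_basis b, Fintype.card_fin]
  have hrepr (k : ℕ) (hk : k ≤ n) (i : Fin n) :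
      b.repr (w k) i = if k = i then 1 else 0 := by
    rcases hk.eq_or_lt with rfl | hlt
    · rw [hn, map_zero, if_neg (by omega)]; rfl
    · rw [← hb ⟨k, hlt⟩, b.repr_self, Finsupp.single_apply]
      simp [Fin.ext_iff]
  have hxne (j : ℕ) (hj0 : 0 < j) (hj : j < n) : x j ≠ 0 := by
    intro hxj
    have hle : Submodule.span ℂ (w '' {k | j ≤ k ∧ k < n}) ≤
        LinearMap.ker (b.coord ⟨0, hn0⟩) := by
      rw [Submodule.span_le]
      rintro _ ⟨k, ⟨hk, hkn⟩, rfl⟩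
      rw [SetLike.mem_coe, LinearMap.mem_ker, Module.Basis.coord_apply, hrepr k hkn.le,
        if_neg (by simp; omega)]
    rw [hspan j hj hxj] at hle
    have := hle (Submodule.mem_top (x := w 0))
    rw [LinearMap.mem_ker, Module.Basis.coord_apply, hrepr 0 hn0.le] at this
    simp at this
  have hmat (i j : Fin n) : LinearMap.toMatrix b b A i j =
      (if (j : ℕ) + 1 = i then 1 else 0) + a j * (if (j : ℕ) = i then 1 else 0)
        + x j * (if (j : ℕ) - 1 = i then 1 else 0) := by
    rw [LinearMap.toMatrix_apply, hb, hAw, map_add, map_add, map_smul, map_smul]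
    simp only [Finsupp.add_apply, Finsupp.smul_apply, smul_eq_mul]
    rw [hrepr _ (by omega), hrepr _ (by omega), hrepr _ (by omega)]
  rw [← hfr]
  refine ⟨b, fun i j hij => ?_, fun i j hij => ?_, fun i j hij => ?_⟩
  · show LinearMap.toMatrix b b B i j = 0
    rw [LinearMap.toMatrix_apply, hb, hBw, map_smul, Finsupp.smul_apply, hrepr _ (by omega),
      if_neg (fun e => hij (Fin.ext e.symm)), smul_zero]
  · by_contra hcon
    refine hij ?_
    rw [hmat, if_neg (by omega), if_neg (by omega), if_neg (by omega)]
    ring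
  · rw [hmat, hmat, if_neg (by omega), if_neg (by omega), if_pos (by omega), if_pos (by omega),
      if_neg (by omega), if_neg (by omega)]
    have := hxne j (by omega) j.2
    simpa using this

theorem diagTridiagTridiag_of_relations [FiniteDimensional ℂ V] [Nontrivial V]
    {C : Module.End ℂ V} (hirr : IsIrreduciblePair A B)
    (hAB : QuadraticRelation A B δ) (hBA : QuadraticRelation B A δ)
    (hB : ⨆ h : ℤ, eigenspace B (theta h) = ⊤) (hC : A + B + C = algebraMap ℂ _ δ) :
    ∃ b : Module.Basis (Fin (Module.finrank ℂ V)) ℂ V,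
      (LinearMap.toMatrix b b B).IsDiag ∧ IsIrredTridiagonal (LinearMap.toMatrix b b A) ∧
        IsIrredTridiagonal (LinearMap.toMatrix b b C) := by
  obtain ⟨b, hd, ht⟩ := exists_diag_tridiag_basis hirr hAB hBA hB
  refine ⟨b, hd, ht, ht.of_eq_neg fun i j hij => ?_⟩
  have e : C = algebraMap ℂ _ δ - A - B := by rw [← hC]; abel
  have hd' : LinearMap.toMatrix b b B i j = 0 := hd hij
  rw [e, map_sub, map_sub, Matrix.sub_apply, Matrix.sub_apply, hd', sub_zero, sub_eq_neg_self,
    LinearMap.toMatrix_apply, Module.algebraMap_end_apply, map_smul, b.repr_self,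
    Finsupp.smul_apply, Finsupp.single_eq_of_ne hij, smul_zero]

end ChainBasis

end HypercubeRacah

namespace HypercubeRacah

open Finset symmDiff

variable {S : Type*} [DecidableEq S]

/-! ### Distance two in the hypercube -/

section Distance

lemma mem_symmDiff_singleton {x : Finset S} {i j : S} :
    j ∈ x ∆ {i} ↔ (j ∈ x ∧ j ≠ i) ∨ (j = i ∧ j ∉ x) := by
  simp [Finset.mem_symmDiff]

lemma symmDiff_singleton_of_mem {x : Finset S} {i : S} (h : i ∈ x) : x ∆ {i} = x.erase i := by
  ext j; rw [mem_symmDiff_singleton]; grind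

lemma symmDiff_singleton_of_notMem {x : Finset S} {i : S} (h : i ∉ x) :
    x ∆ {i} = insert i x := by
  ext j; rw [mem_symmDiff_singleton]; grind

lemma hypercube_adj_iff {x y : Finset S} : (hypercube S).Adj x y ↔ ∃ i, y = x ∆ {i} := by
  rw [hypercube, SimpleGraph.hasse_adj, Finset.covBy_iff_exists_insert,
    Finset.covBy_iff_exists_erase]
  constructor
  · rintro (⟨i, hi, rfl⟩ | ⟨i, hi, rfl⟩)
    · exact ⟨i, (symmDiff_singleton_of_notMem hi).symm⟩
    · exact ⟨i, (symmDiff_singleton_of_mem hi).symm⟩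
  · rintro ⟨i, rfl⟩
    by_cases hi : i ∈ x
    · exact Or.inr ⟨i, hi, (symmDiff_singleton_of_mem hi).symm⟩
    · exact Or.inl ⟨i, hi, (symmDiff_singleton_of_notMem hi).symm⟩

lemma hypercube_dist_eq_two_iff {x y : Finset S} :
    (hypercube S).dist x y = 2 ↔ (x ∆ y).card = 2 := by
  rw [SimpleGraph.dist, ENat.toNat_eq_iff two_ne_zero, Nat.cast_ofNat,
    SimpleGraph.edist_eq_two_iff, Finset.card_eq_two]
  constructor
  · rintro ⟨hne, -, z, hz⟩
    rw [SimpleGraph.mem_commonNeighbors, hypercube_adj_iff, hypercube_adj_iff] at hz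
    obtain ⟨⟨i, hi⟩, j, hj⟩ := hz
    have hy : y = x ∆ ({i} ∆ {j}) := by
      rw [← symmDiff_assoc, ← hi, hj, symmDiff_symmDiff_cancel_right]
    have hij : i ≠ j := by
      rintro rfl
      rw [symmDiff_self, symmDiff_bot] at hy
      exact hne hy.symm
    refine ⟨i, j, hij, ?_⟩
    rw [hy, symmDiff_symmDiff_cancel_left]
    ext k; rw [mem_symmDiff_singleton]; grind
  · rintro ⟨i, j, hij, h⟩
    have hy : y = x ∆ {i, j} := by rw [← h, symmDiff_symmDiff_cancel_left]
    have hpair : ({i, j} : Finset S) = {i} ∆ {j} := by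
      ext k; rw [mem_symmDiff_singleton]; grind
    refine ⟨?_, ?_, x ∆ {i}, ?_⟩
    · rintro rfl
      rw [symmDiff_self] at h
      exact absurd h.symm (Finset.insert_ne_empty _ _)
    · rw [hypercube_adj_iff]
      rintro ⟨k, rfl⟩
      rw [symmDiff_symmDiff_cancel_left] at h
      have := congrArg Finset.card h
      rw [Finset.card_pair hij, Finset.card_singleton] at this
      omega
    · rw [SimpleGraph.mem_commonNeighbors, hypercube_adj_iff, hypercube_adj_iff]
      refine ⟨⟨i, rfl⟩, j, ?_⟩
      rw [hy, hpair, ← symmDiff_assoc, symmDiff_symmDiff_cancel_right]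

lemma symmDiff_singleton_symmDiff {x : Finset S} {i j : S} (hij : i ≠ j) :
    x ∆ {i} ∆ {j} = x ∆ {i, j} := by
  rw [symmDiff_assoc]
  congr 1
  ext k; rw [mem_symmDiff_singleton]; grind

/-- Each `y` at distance two arises from both orderings of the pair `x ∆ y`. -/
lemma sum_offDiag_symmDiff [Fintype S] {M : Type*} [AddCommMonoid M] (x : Finset S)
    (g : Finset S → M) :
    ∑ p ∈ (univ : Finset S).offDiag, g (x ∆ {p.1, p.2}) =
      2 • ∑ y with (hypercube S).dist x y = 2, g y := by
  simp only [hypercube_dist_eq_two_iff]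
  rw [← Finset.sum_fiberwise_of_maps_to (t := univ.filter fun y => (x ∆ y).card = 2)
    (g := fun p : S × S => x ∆ {p.1, p.2}), Finset.smul_sum]
  · refine Finset.sum_congr rfl fun y hy => ?_
    obtain ⟨a, b, hab, h⟩ := Finset.card_eq_two.1 (Finset.mem_filter.1 hy).2
    have hfil : (univ : Finset S).offDiag.filter (fun p => x ∆ {p.1, p.2} = y)
        = {(a, b), (b, a)} := by
      ext ⟨i, j⟩
      have : x ∆ {i, j} = y ↔ ({i, j} : Finset S) = {a, b} := by
        rw [← h]
        constructor
        · rintro rfl; rw [symmDiff_symmDiff_cancel_left]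
        · intro e; rw [e, symmDiff_symmDiff_cancel_left]
      simp only [Finset.mem_filter, this, Finset.mem_offDiag, Finset.mem_univ, true_and,
        Finset.mem_insert, Finset.mem_singleton, Prod.mk.injEq]
      constructor
      · rintro ⟨hij, e⟩
        have h1 : i ∈ ({a, b} : Finset S) := e ▸ by simp
        have h2 : j ∈ ({a, b} : Finset S) := e ▸ by simp
        grind
      · rintro (⟨rfl, rfl⟩ | ⟨rfl, rfl⟩)
        · exact ⟨hab, rfl⟩
        · exact ⟨hab.symm, Finset.pair_comm _ _⟩
    rw [Finset.sum_congr rfl (g := fun _ => g y)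
      fun p hp => by rw [(Finset.mem_filter.1 hp).2], hfil, Finset.sum_const,
      Finset.card_pair (by simp [hab])]
  · rintro ⟨i, j⟩ hp
    simp only [Finset.mem_offDiag, Finset.mem_univ, true_and] at hp
    simp [Finset.card_pair hp]

end Distance

/-! ### Pauli operators on single coordinates -/

section Pauli

/-- The sign recording whether `i` belongs to `x`. -/
noncomputable def spinSign (i : S) (x : Finset S) : ℂ := if i ∈ x then -1 else 1

lemma spinSign_mul_self (i : S) (x : Finset S) : spinSign i x * spinSign i x = 1 := by
  unfold spinSign; split_ifs <;> norm_num

lemma spinSign_symmDiff_self (i : S) (x : Finset S) :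
    spinSign i (x ∆ {i}) = -spinSign i x := by
  unfold spinSign
  simp only [mem_symmDiff_singleton]
  by_cases h : i ∈ x <;> simp [h]

lemma spinSign_symmDiff_of_ne {i j : S} (hij : i ≠ j) (x : Finset S) :
    spinSign i (x ∆ {j}) = spinSign i x := by
  unfold spinSign
  simp only [mem_symmDiff_singleton]
  by_cases h : i ∈ x <;> simp [h, hij]

/-- The operator on functions flipping the membership of `i`. -/
def flipX (i : S) : Module.End ℂ (Finset S → ℂ) where
  toFun f x := f (x ∆ {i})
  map_add' _ _ := rfl
  map_smul' _ _ := rfl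

/-- The operator on functions multiplying by the sign of `i`. -/
noncomputable def signZ (i : S) : Module.End ℂ (Finset S → ℂ) where
  toFun f x := spinSign i x * f x
  map_add' f g := by ext x; simp [mul_add]
  map_smul' c f := by ext x; simp [mul_left_comm]

/-- The product `√-1 Z X` of the sign and the flip of `i`. -/
noncomputable def flipY (i : S) : Module.End ℂ (Finset S → ℂ) := Complex.I • (signZ i * flipX i)

lemma flipX_apply (i : S) (f : Finset S → ℂ) (x : Finset S) : flipX i f x = f (x ∆ {i}) := rfl

lemma signZ_apply (i : S) (f : Finset S → ℂ) (x : Finset S) :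
    signZ i f x = spinSign i x * f x := rfl

lemma flipY_apply (i : S) (f : Finset S → ℂ) (x : Finset S) :
    flipY i f x = Complex.I * (spinSign i x * f (x ∆ {i})) := rfl

lemma flipX_mul_self (i : S) : flipX i * flipX i = 1 := by
  ext1; ext x
  simp [flipX_apply]

lemma signZ_mul_self (i : S) : signZ i * signZ i = 1 := by
  refine LinearMap.ext fun f => funext fun x => ?_
  simp only [Module.End.mul_apply, signZ_apply, ← mul_assoc, spinSign_mul_self, one_mul,
    Module.End.one_apply]

lemma flipY_mul_self (i : S) : flipY i * flipY i = 1 := by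
  refine LinearMap.ext fun f => funext fun x => ?_
  simp only [Module.End.mul_apply, flipY_apply, Module.End.one_apply, spinSign_symmDiff_self,
    symmDiff_symmDiff_cancel_right]
  linear_combination (-f x * spinSign i x * spinSign i x) * Complex.I_mul_I
    + f x * spinSign_mul_self i x

lemma commute_flipX_flipX (i j : S) : Commute (flipX i) (flipX j) := by
  refine LinearMap.ext fun f => funext fun x => ?_
  simp only [Module.End.mul_apply, flipX_apply]
  rw [symmDiff_right_comm]

lemma commute_signZ_signZ (i j : S) : Commute (signZ i) (signZ j) := by
  refine LinearMap.ext fun f => funext fun x => ?_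
  simp only [Module.End.mul_apply, signZ_apply]
  ring

lemma commute_flipX_signZ {i j : S} (hij : i ≠ j) : Commute (flipX i) (signZ j) := by
  refine LinearMap.ext fun f => funext fun x => ?_
  simp only [Module.End.mul_apply, signZ_apply, flipX_apply, spinSign_symmDiff_of_ne hij.symm]

lemma commute_flipX_flipY {i j : S} (hij : i ≠ j) : Commute (flipX i) (flipY j) :=
  ((commute_flipX_signZ hij).mul_right (commute_flipX_flipX i j)).smul_right _

lemma commute_signZ_flipY {i j : S} (hij : i ≠ j) : Commute (signZ i) (flipY j) :=
  ((commute_signZ_signZ i j).mul_right (commute_flipX_signZ hij.symm).symm).smul_right _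

lemma commute_flipY_flipY (i j : S) : Commute (flipY i) (flipY j) := by
  by_cases hij : i = j
  · rw [hij]
  · exact (((commute_signZ_flipY hij).mul_left (commute_flipX_flipY hij))).smul_left _

lemma commutator_flipX_signZ (i : S) :
    flipX i * signZ i - signZ i * flipX i = (2 * Complex.I) • flipY i := by
  refine LinearMap.ext fun f => funext fun x => ?_
  simp only [LinearMap.sub_apply, LinearMap.smul_apply, Pi.sub_apply, Pi.smul_apply, smul_eq_mul,
    Module.End.mul_apply, signZ_apply, flipX_apply, flipY_apply, spinSign_symmDiff_self]
  linear_combination (-2 * (spinSign i x * f (x ∆ {i}))) * Complex.I_mul_I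

lemma commutator_signZ_flipY (i : S) :
    signZ i * flipY i - flipY i * signZ i = (2 * Complex.I) • flipX i := by
  refine LinearMap.ext fun f => funext fun x => ?_
  simp only [LinearMap.sub_apply, LinearMap.smul_apply, Pi.sub_apply, Pi.smul_apply, smul_eq_mul,
    Module.End.mul_apply, signZ_apply, flipX_apply, flipY_apply, spinSign_symmDiff_self]
  linear_combination (2 * Complex.I * f (x ∆ {i})) * spinSign_mul_self i x

lemma commutator_flipY_flipX (i : S) :
    flipY i * flipX i - flipX i * flipY i = (2 * Complex.I) • signZ i := by
  refine LinearMap.ext fun f => funext fun x => ?_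
  simp only [LinearMap.sub_apply, LinearMap.smul_apply, Pi.sub_apply, Pi.smul_apply, smul_eq_mul,
    Module.End.mul_apply, signZ_apply, flipX_apply, flipY_apply, spinSign_symmDiff_self,
    symmDiff_symmDiff_cancel_right]
  ring

lemma flipX_single (i : S) (x : Finset S) :
    flipX i (Pi.single x (1 : ℂ)) = Pi.single (x ∆ {i}) 1 := by
  ext y
  rw [flipX_apply, Pi.single_apply, Pi.single_apply]
  congr 1
  rw [eq_iff_iff]
  constructor
  · rintro rfl; rw [symmDiff_symmDiff_cancel_right]
  · rintro rfl; rw [symmDiff_symmDiff_cancel_right]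

lemma signZ_single (i : S) (x : Finset S) :
    signZ i (Pi.single x (1 : ℂ)) = spinSign i x • Pi.single x 1 := by
  ext y
  rw [signZ_apply, Pi.smul_apply, Pi.single_apply]
  split_ifs with h
  · rw [h, smul_eq_mul]
  · simp

lemma flipY_single (i : S) (x : Finset S) :
    flipY i (Pi.single x (1 : ℂ)) = (-Complex.I * spinSign i x) • Pi.single (x ∆ {i}) 1 := by
  rw [flipY, LinearMap.smul_apply, Module.End.mul_apply, flipX_single, signZ_single, smul_smul,
    spinSign_symmDiff_self, mul_neg, neg_mul]

/-- Flipping two coordinates preserves the size exactly when one of them lies in `x` and the other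
does not. This sign separates `J` from `J̄` in `totalY_sq`. -/
lemma card_symmDiff_pair_sign {x : Finset S} {i j : S} (hij : i ≠ j) :
    (if (x ∆ {i, j}).card = x.card then 1 else -1 : ℂ) = -(spinSign i x * spinSign j x) := by
  rw [← symmDiff_singleton_symmDiff hij]
  have hjm : j ∈ x ∆ {i} ↔ j ∈ x := by rw [mem_symmDiff_singleton]; grind
  unfold spinSign
  by_cases hi : i ∈ x <;> by_cases hj : j ∈ x
  · have h1 : 0 < x.card := Finset.card_pos.2 ⟨i, hi⟩
    rw [symmDiff_singleton_of_mem (hjm.2 hj), Finset.card_erase_of_mem (hjm.2 hj),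
      symmDiff_singleton_of_mem hi, Finset.card_erase_of_mem hi, if_neg (by omega)]
    simp [hi, hj]
  · have h1 : 0 < x.card := Finset.card_pos.2 ⟨i, hi⟩
    rw [symmDiff_singleton_of_notMem (fun h => hj (hjm.1 h)),
      Finset.card_insert_of_notMem (fun h => hj (hjm.1 h)),
      symmDiff_singleton_of_mem hi, Finset.card_erase_of_mem hi, if_pos (by omega)]
    simp [hi, hj]
  · rw [symmDiff_singleton_of_mem (hjm.2 hj), Finset.card_erase_of_mem (hjm.2 hj),
      symmDiff_singleton_of_notMem hi, Finset.card_insert_of_notMem hi, if_pos (by omega)]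
    simp [hi, hj]
  · rw [symmDiff_singleton_of_notMem (fun h => hj (hjm.1 h)),
      Finset.card_insert_of_notMem (fun h => hj (hjm.1 h)),
      symmDiff_singleton_of_notMem hi, Finset.card_insert_of_notMem hi, if_neg (by omega)]
    simp [hi, hj]

end Pauli

/-! ### Total operators, their squares and spectra -/

section Total

variable [Fintype S]

variable (S) in
/-- The total flip operator, the adjacency operator of the hypercube. -/
def totalX : Module.End ℂ (Finset S → ℂ) := ∑ i, flipX i

variable (S) in
/-- The sum of the operators `flipY`. -/
noncomputable def totalY : Module.End ℂ (Finset S → ℂ) := ∑ i, flipY i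

variable (S) in
/-- The sum of the sign operators, the dual adjacency operator of the hypercube. -/
noncomputable def totalZ : Module.End ℂ (Finset S → ℂ) := ∑ i, signZ i

lemma commutator_totalX_totalZ :
    totalX S * totalZ S - totalZ S * totalX S = (2 * Complex.I) • totalY S := by
  rw [totalX, totalY, totalZ, Finset.smul_sum]
  exact commutator_sum commutator_flipX_signZ fun _ _ => commute_flipX_signZ

lemma commutator_totalZ_totalY :
    totalZ S * totalY S - totalY S * totalZ S = (2 * Complex.I) • totalX S := by
  rw [totalX, totalY, totalZ, Finset.smul_sum]
  exact commutator_sum commutator_signZ_flipY fun _ _ => commute_signZ_flipY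

lemma commutator_totalY_totalX :
    totalY S * totalX S - totalX S * totalY S = (2 * Complex.I) • totalZ S := by
  rw [totalX, totalY, totalZ, Finset.smul_sum]
  exact commutator_sum commutator_flipY_flipX fun _ _ h => (commute_flipX_flipY h.symm).symm

/-- The order `X`, `Z`, `Y` matches `A`, `B`, `C`. -/
lemma isRotationTriple_total :
    IsRotationTriple ((2 * Complex.I)⁻¹ • totalX S) ((2 * Complex.I)⁻¹ • totalZ S)
      ((2 * Complex.I)⁻¹ • totalY S) := by
  have hI : (2 * Complex.I) ≠ 0 := mul_ne_zero two_ne_zero Complex.I_ne_zero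
  have hscale {a b c : Module.End ℂ (Finset S → ℂ)} (h : a * b - b * a = (2 * Complex.I) • c) :
      ((2 * Complex.I)⁻¹ • a) * ((2 * Complex.I)⁻¹ • b)
        - ((2 * Complex.I)⁻¹ • b) * ((2 * Complex.I)⁻¹ • a) = (2 * Complex.I)⁻¹ • c := by
    rw [smul_mul_smul_comm, smul_mul_smul_comm,
      show ∀ (r : ℂ) (s t : Module.End ℂ (Finset S → ℂ)), r • s - r • t = r • (s - t) from
        fun r s t => (smul_sub r s t).symm, h, mul_smul, inv_smul_smul₀ hI]
  exact ⟨hscale commutator_totalX_totalZ, hscale commutator_totalZ_totalY,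
    hscale commutator_totalY_totalX⟩

lemma sum_sum_eq_diag_add_offDiag {M : Type*} [AddCommMonoid M] (F : S → S → M) :
    ∑ i, ∑ j, F i j = ∑ i, F i i + ∑ p ∈ (univ : Finset S).offDiag, F p.1 p.2 := by
  rw [← Finset.sum_product', ← Finset.diag_union_offDiag,
    Finset.sum_union (Finset.disjoint_diag_offDiag _)]
  simp

lemma opJ_single (x : Finset S) : opJ S (Pi.single x 1) =
    ∑ y : Finset S with y.card = x.card ∧ (hypercube S).dist x y = 2, Pi.single y (1 : ℂ) := by
  rw [← Pi.basisFun_apply, opJ, Module.Basis.constr_basis]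

lemma opJbar_single (x : Finset S) : opJbar S (Pi.single x 1) =
    ∑ y : Finset S with y.card ≠ x.card ∧ (hypercube S).dist x y = 2, Pi.single y (1 : ℂ) := by
  rw [← Pi.basisFun_apply, opJbar, Module.Basis.constr_basis]

lemma opStar_single (x : Finset S) : opStar S (Pi.single x 1) =
    ((((Fintype.card S : ℂ) - 2 * (x.card : ℂ)) ^ 2 - (Fintype.card S : ℂ)) / 2) •
      Pi.single x (1 : ℂ) := by
  rw [← Pi.basisFun_apply, opStar, Module.Basis.constr_basis, Pi.basisFun_apply]

lemma opJ_add_opJbar_single (x : Finset S) : (opJ S + opJbar S) (Pi.single x 1) =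
    ∑ y : Finset S with (hypercube S).dist x y = 2, Pi.single y (1 : ℂ) := by
  rw [LinearMap.add_apply, opJ_single, opJbar_single,
    ← Finset.sum_filter_add_sum_filter_not (univ.filter fun y => (hypercube S).dist x y = 2)
      (fun y : Finset S => y.card = x.card),
    Finset.filter_filter, Finset.filter_filter]
  simp only [and_comm (b := (hypercube S).dist _ _ = 2), ne_eq]

lemma opJ_sub_opJbar_single (x : Finset S) : (opJ S - opJbar S) (Pi.single x 1) =
    ∑ y : Finset S with (hypercube S).dist x y = 2,
      (if y.card = x.card then 1 else -1 : ℂ) • Pi.single y (1 : ℂ) := by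
  rw [LinearMap.sub_apply, opJ_single, opJbar_single,
    ← Finset.sum_filter_add_sum_filter_not (univ.filter fun y => (hypercube S).dist x y = 2)
      (fun y : Finset S => y.card = x.card),
    Finset.filter_filter, Finset.filter_filter]
  simp only [and_comm (b := (hypercube S).dist _ _ = 2), ne_eq]
  rw [sub_eq_add_neg, ← Finset.sum_neg_distrib]
  congr 1
  · refine Finset.sum_congr rfl fun y hy => ?_
    rw [if_pos (Finset.mem_filter.1 hy).2.2, one_smul]
  · refine Finset.sum_congr rfl fun y hy => ?_
    rw [if_neg (Finset.mem_filter.1 hy).2.2, neg_one_smul]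

lemma totalX_sq : totalX S * totalX S =
    algebraMap ℂ _ (Fintype.card S : ℂ) + (2 : ℂ) • (opJ S + opJbar S) := by
  refine (Pi.basisFun ℂ (Finset S)).ext fun x => ?_
  rw [Pi.basisFun_apply, LinearMap.add_apply, LinearMap.smul_apply, opJ_add_opJbar_single,
    Module.algebraMap_end_apply, totalX, Finset.sum_mul_sum, ofNat_smul_eq_nsmul ℂ,
    ← sum_offDiag_symmDiff, sum_sum_eq_diag_add_offDiag, LinearMap.add_apply]
  simp only [LinearMap.sum_apply, Module.End.mul_apply, flipX_single,
    symmDiff_symmDiff_cancel_right]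
  congr 1
  · simp only [Finset.sum_const, Finset.card_univ, Nat.cast_smul_eq_nsmul]
  · refine Finset.sum_congr rfl fun p hp => ?_
    rw [symmDiff_singleton_symmDiff (Finset.mem_offDiag.1 hp).2.2.symm, Finset.pair_comm]

lemma totalY_sq : totalY S * totalY S =
    algebraMap ℂ _ (Fintype.card S : ℂ) + (2 : ℂ) • (opJ S - opJbar S) := by
  refine (Pi.basisFun ℂ (Finset S)).ext fun x => ?_
  rw [Pi.basisFun_apply, LinearMap.add_apply, LinearMap.smul_apply, opJ_sub_opJbar_single,
    Module.algebraMap_end_apply, totalY, Finset.sum_mul_sum, ofNat_smul_eq_nsmul ℂ,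
    ← sum_offDiag_symmDiff x fun y => (if y.card = x.card then 1 else -1 : ℂ) •
      Pi.single y (1 : ℂ), sum_sum_eq_diag_add_offDiag, LinearMap.add_apply]
  simp only [LinearMap.sum_apply, flipY_mul_self]
  congr 1
  · simp only [Module.End.one_apply, Finset.sum_const, Finset.card_univ, Nat.cast_smul_eq_nsmul]
  · refine Finset.sum_congr rfl fun p hp => ?_
    have hne := (Finset.mem_offDiag.1 hp).2.2
    rw [Module.End.mul_apply, flipY_single, map_smul, flipY_single,
      symmDiff_singleton_symmDiff hne.symm, Finset.pair_comm, card_symmDiff_pair_sign hne,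
      spinSign_symmDiff_of_ne hne, smul_smul]
    congr 1
    linear_combination (spinSign p.1 x * spinSign p.2 x) * Complex.I_mul_I

lemma sum_spinSign (x : Finset S) :
    ∑ i, spinSign i x = (Fintype.card S : ℂ) - 2 * (x.card : ℂ) := by
  have h (i : S) : spinSign i x = 1 - 2 * (if i ∈ x then 1 else 0) := by
    unfold spinSign; split_ifs <;> norm_num
  simp [h, Finset.sum_sub_distrib, mul_comm]

lemma totalZ_single (x : Finset S) : totalZ S (Pi.single x 1) =
    ((Fintype.card S : ℂ) - 2 * (x.card : ℂ)) • Pi.single x (1 : ℂ) := by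
  rw [totalZ, LinearMap.sum_apply, ← sum_spinSign, Finset.sum_smul]
  exact Finset.sum_congr rfl fun i _ => signZ_single i x

lemma totalZ_sq : totalZ S * totalZ S =
    algebraMap ℂ _ (Fintype.card S : ℂ) + (2 : ℂ) • opStar S := by
  refine (Pi.basisFun ℂ (Finset S)).ext fun x => ?_
  rw [Pi.basisFun_apply, LinearMap.add_apply, LinearMap.smul_apply, opStar_single,
    Module.algebraMap_end_apply, Module.End.mul_apply, totalZ_single, map_smul, totalZ_single]
  module

lemma iSup_eigenspace_totalX :
    ⨆ h : ℤ, Module.End.eigenspace (totalX S) (h : ℂ) = ⊤ :=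
  iSup_eigenspace_sum_involution flipX_mul_self commute_flipX_flipX _

lemma iSup_eigenspace_totalY :
    ⨆ h : ℤ, Module.End.eigenspace (totalY S) (h : ℂ) = ⊤ :=
  iSup_eigenspace_sum_involution flipY_mul_self commute_flipY_flipY _

lemma iSup_eigenspace_totalZ :
    ⨆ h : ℤ, Module.End.eigenspace (totalZ S) (h : ℂ) = ⊤ :=
  iSup_eigenspace_sum_involution signZ_mul_self commute_signZ_signZ _

end Total

end HypercubeRacah

namespace HypercubeRacah

open Module.End

/-! ### Racah relations in `𝐑` -/

section Relations

variable (S : Type*) [Fintype S] [DecidableEq S]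

/-- The image of `A`. -/
noncomputable def racA : algR S := algebraMap ℂ (algR S) ((Fintype.card S : ℂ) / 16 - 1 / 4)
  + (1 / 8 : ℂ) • (genJ S + genJbar S)

/-- The image of `B`. -/
noncomputable def racB : algR S := algebraMap ℂ (algR S) ((Fintype.card S : ℂ) / 16 - 1 / 4)
  + (1 / 8 : ℂ) • genStar S

/-- The image of `C`. -/
noncomputable def racC : algR S := algebraMap ℂ (algR S) ((Fintype.card S : ℂ) / 16 - 1 / 4)
  + (1 / 8 : ℂ) • (genJ S - genJbar S)

lemma coe_racA : (racA S : Module.End ℂ (Finset S → ℂ)) =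
    (1 / 16 : ℂ) • (totalX S * totalX S - algebraMap ℂ _ 4) := by
  rw [totalX_sq]
  simp only [racA, genJ, genJbar, Subalgebra.coe_add, Subalgebra.coe_smul,
    Algebra.algebraMap_eq_smul_one]
  module

lemma coe_racB : (racB S : Module.End ℂ (Finset S → ℂ)) =
    (1 / 16 : ℂ) • (totalZ S * totalZ S - algebraMap ℂ _ 4) := by
  rw [totalZ_sq]
  simp only [racB, genStar, Subalgebra.coe_add, Subalgebra.coe_smul,
    Algebra.algebraMap_eq_smul_one]
  module

lemma coe_racC : (racC S : Module.End ℂ (Finset S → ℂ)) =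
    (1 / 16 : ℂ) • (totalY S * totalY S - algebraMap ℂ _ 4) := by
  rw [totalY_sq]
  simp only [racC, genJ, genJbar, Subalgebra.coe_add, Subalgebra.coe_sub, Subalgebra.coe_smul,
    Algebra.algebraMap_eq_smul_one]
  module

/-- The relations satisfied by the images of `A`, `B`, `C`, invariant under cyclic permutation. -/
structure IsRacahTriple {E : Type*} [Ring E] [Algebra ℂ E] (A B C : E) : Prop where
  comm_eq : A * B - B * A = B * C - C * B
  double_comm : A * (A * B - B * A) - (A * B - B * A) * A = (2 : ℂ) • (B * A - A * C)

lemma IsRotationTriple.isRacahTriple {E : Type*} [Ring E] [Algebra ℂ E] {x y z A B C : E}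
    (h : IsRotationTriple x y z) (hA : A = (-1 / 4 : ℂ) • (x * x + 1))
    (hB : B = (-1 / 4 : ℂ) • (y * y + 1)) (hC : C = (-1 / 4 : ℂ) • (z * z + 1)) :
    IsRacahTriple A B C := by
  have expand (s t : E) : (s + 1) * (t + 1) - (t + 1) * (s + 1) = s * t - t * s := by
    noncomm_ring
  have expand' (s u : E) : (s + 1) * u - u * (s + 1) = s * u - u * s := by noncomm_ring
  have hAB : A * B - B * A = (1 / 16 : ℂ) • (x * x * (y * y) - y * y * (x * x)) := by
    rw [hA, hB, smul_mul_smul_comm, smul_mul_smul_comm]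
    linear_combination (norm := module) (1 / 16 : ℂ) • expand (x * x) (y * y)
  have hBC : B * C - C * B = (1 / 16 : ℂ) • (y * y * (z * z) - z * z * (y * y)) := by
    rw [hB, hC, smul_mul_smul_comm, smul_mul_smul_comm]
    linear_combination (norm := module) (1 / 16 : ℂ) • expand (y * y) (z * z)
  refine ⟨by rw [hAB, hBC, h.comm_sq], ?_⟩
  have e := h.double_comm_sq
  rw [← expand'] at e
  rw [hAB, hA, hB, hC, smul_mul_smul_comm, smul_mul_smul_comm, smul_mul_smul_comm,
    smul_mul_smul_comm]
  have e8 (t : E) : -8 * t = (-8 : ℂ) • t := by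
    rw [neg_smul, ofNat_smul_eq_nsmul, nsmul_eq_mul, neg_mul]; norm_num
  rw [e8] at e
  linear_combination (norm := module) (-1 / 64 : ℂ) • e

lemma isRacahTriple_of_totals {x y z : Module.End ℂ (Finset S → ℂ)} {A B C : algR S}
    (h : IsRotationTriple ((2 * Complex.I)⁻¹ • x) ((2 * Complex.I)⁻¹ • y)
      ((2 * Complex.I)⁻¹ • z))
    (hA : (A : Module.End ℂ (Finset S → ℂ)) = (1 / 16 : ℂ) • (x * x - algebraMap ℂ _ 4))
    (hB : (B : Module.End ℂ (Finset S → ℂ)) = (1 / 16 : ℂ) • (y * y - algebraMap ℂ _ 4))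
    (hC : (C : Module.End ℂ (Finset S → ℂ)) = (1 / 16 : ℂ) • (z * z - algebraMap ℂ _ 4)) :
    IsRacahTriple A B C := by
  have hI : (2 * Complex.I)⁻¹ * (2 * Complex.I)⁻¹ = -1 / 4 := by
    rw [← mul_inv, mul_mul_mul_comm, Complex.I_mul_I]; norm_num
  have hscale (s : Module.End ℂ (Finset S → ℂ)) :
      (1 / 16 : ℂ) • (s * s - algebraMap ℂ _ 4) =
        (-1 / 4 : ℂ) • (((2 * Complex.I)⁻¹ • s) * ((2 * Complex.I)⁻¹ • s) + 1) := by
    rw [smul_mul_smul_comm, hI, Algebra.algebraMap_eq_smul_one]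
    module
  have := h.isRacahTriple (hA.trans (hscale x)) (hB.trans (hscale y)) (hC.trans (hscale z))
  exact ⟨Subtype.ext this.comm_eq, Subtype.ext this.double_comm⟩

lemma isRacahTriple_ABC : IsRacahTriple (racA S) (racB S) (racC S) :=
  isRacahTriple_of_totals S isRotationTriple_total (coe_racA S) (coe_racB S) (coe_racC S)

lemma isRacahTriple_BCA : IsRacahTriple (racB S) (racC S) (racA S) :=
  isRacahTriple_of_totals S isRotationTriple_total.cycle (coe_racB S) (coe_racC S) (coe_racA S)

lemma isRacahTriple_CAB : IsRacahTriple (racC S) (racA S) (racB S) :=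
  isRacahTriple_of_totals S isRotationTriple_total.cycle.cycle (coe_racC S) (coe_racA S)
    (coe_racB S)

/-- The three generators of `𝐑` are affine combinations of the images of `A`, `B`, `C`. -/
lemma subalgebra_eq_top_of_mem {T : Subalgebra ℂ (algR S)} (hA : racA S ∈ T) (hB : racB S ∈ T)
    (hC : racC S ∈ T) : T = ⊤ := by
  have hscal (c : ℂ) : algebraMap ℂ (algR S) c ∈ T := T.algebraMap_mem c
  have hJ : genJ S ∈ T := by
    have e : genJ S = (4 : ℂ) • (racA S + racC S)
        + algebraMap ℂ _ (2 - (Fintype.card S : ℂ) / 2) := by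
      simp only [racA, racC, Algebra.algebraMap_eq_smul_one]; module
    rw [e]
    exact add_mem (T.smul_mem (add_mem hA hC) (4 : ℂ)) (hscal _)
  have hJbar : genJbar S ∈ T := by
    have e : genJbar S = (4 : ℂ) • racA S + (-4 : ℂ) • racC S := by
      simp only [racA, racC, Algebra.algebraMap_eq_smul_one]; module
    rw [e]
    exact add_mem (T.smul_mem hA (4 : ℂ)) (T.smul_mem hC (-4 : ℂ))
  have hStar : genStar S ∈ T := by
    have e : genStar S = (8 : ℂ) • racB S
        + algebraMap ℂ _ (2 - (Fintype.card S : ℂ) / 2) := by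
      simp only [racB, Algebra.algebraMap_eq_smul_one]; module
    rw [e]
    exact add_mem (T.smul_mem hB (8 : ℂ)) (hscal _)
  have hle : algR S ≤ T.map (algR S).val := by
    refine Algebra.adjoin_le ?_
    rintro _ (rfl | rfl | rfl)
    · exact ⟨_, hJ, rfl⟩
    · exact ⟨_, hJbar, rfl⟩
    · exact ⟨_, hStar, rfl⟩
  rw [eq_top_iff]
  rintro r -
  obtain ⟨t, ht, e⟩ := hle r.2
  rwa [← Subtype.ext e]

end Relations

/-! ### The homomorphism from the Racah algebra -/

section Homomorphism

variable (S : Type*) [Fintype S] [DecidableEq S]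

/-- The images of the generators of `ℜ`. -/
noncomputable def racahGenImage : RacahGen → algR S
  | .A => racA S
  | .B => racB S
  | .C => racC S
  | .Δ => (1 / 2 : ℂ) • (racA S * racB S - racB S * racA S)

/-- The elements required to be central are sent to zero. -/
lemma central_of_double_comm {E : Type*} [Ring E] [Algebra ℂ E] {A B C d : E}
    (h : IsRacahTriple A B C) (hd : d = A * B - B * A) :
    (A * ((1 / 2 : ℂ) • d) - ((1 / 2 : ℂ) • d) * A) + A * C - B * A = 0 := by
  have e := h.double_comm
  rw [← hd] at e
  rw [mul_smul_comm, smul_mul_assoc]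
  linear_combination (norm := module) (1 / 2 : ℂ) • e

/-- The homomorphism `ℜ → 𝐑`. -/
noncomputable def racahHom : Racah →ₐ[ℂ] algR S :=
  RingQuot.liftAlgHom ℂ ⟨FreeAlgebra.lift ℂ (racahGenImage S), by
    have hABC := isRacahTriple_ABC S
    have hBCA := isRacahTriple_BCA S
    have hCAB := isRacahTriple_CAB S
    have h1 := hABC.comm_eq
    have h2 := hBCA.comm_eq
    have hΔ : FreeAlgebra.lift ℂ (racahGenImage S) (2 * gen .Δ) =
        racA S * racB S - racB S * racA S := by
      rw [two_mul, map_add, FreeAlgebra.lift_ι_apply, racahGenImage]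
      module
    rintro _ _ (_ | _ | _ | x | x | x)
    · refine Eq.trans ?_ hΔ.symm
      simp [racahGenImage]
    · refine Eq.trans ?_ (hΔ.trans h1).symm
      simp [racahGenImage]
    · refine Eq.trans ?_ (hΔ.trans (h1.trans h2)).symm
      simp [racahGenImage]
    · have : FreeAlgebra.lift ℂ (racahGenImage S) preAlpha = 0 := by
        simpa [preAlpha, racahGenImage] using central_of_double_comm hABC rfl
      rw [map_mul, map_mul, this, zero_mul, mul_zero]
    · have : FreeAlgebra.lift ℂ (racahGenImage S) preBeta = 0 := by
        simpa [preBeta, racahGenImage] using central_of_double_comm hBCA h1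
      rw [map_mul, map_mul, this, zero_mul, mul_zero]
    · have : FreeAlgebra.lift ℂ (racahGenImage S) preGamma = 0 := by
        simpa [preGamma, racahGenImage] using central_of_double_comm hCAB (h1.trans h2)
      rw [map_mul, map_mul, this, zero_mul, mul_zero]⟩

lemma racahHom_of (g : RacahGen) : racahHom S (Racah.of g) = racahGenImage S g := by
  rw [racahHom, Racah.of, RingQuot.liftAlgHom_mkAlgHom_apply, FreeAlgebra.lift_ι_apply]

lemma racahHom_hasPrescribedValues : HasPrescribedValues S (racahHom S) :=
  ⟨racahHom_of S .A, racahHom_of S .B, racahHom_of S .C⟩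

lemma Racah.of_delta :
    Racah.of .Δ = (1 / 2 : ℂ) • (Racah.of .A * Racah.of .B - Racah.of .B * Racah.of .A) := by
  have h := RingQuot.mkAlgHom_rel ℂ RacahRel.comm_AB
  rw [map_sub, map_mul, map_mul, map_mul, map_ofNat] at h
  simp only [Racah.of]
  rw [h, two_mul]
  module

lemma hasPrescribedValues_unique {φ ψ : Racah →ₐ[ℂ] algR S} (hφ : HasPrescribedValues S φ)
    (hψ : HasPrescribedValues S ψ) : φ = ψ := by
  have hA : φ (Racah.of .A) = ψ (Racah.of .A) := hφ.1.trans hψ.1.symm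
  have hB : φ (Racah.of .B) = ψ (Racah.of .B) := hφ.2.1.trans hψ.2.1.symm
  have hC : φ (Racah.of .C) = ψ (Racah.of .C) := hφ.2.2.trans hψ.2.2.symm
  have hΔ : φ (Racah.of .Δ) = ψ (Racah.of .Δ) := by
    rw [Racah.of_delta]
    simp only [map_smul, map_sub, map_mul, hA, hB]
  refine RingQuot.ringQuot_ext' ℂ _ _ (FreeAlgebra.hom_ext (funext fun g => ?_))
  cases g
  · exact hA
  · exact hB
  · exact hC
  · exact hΔ

lemma surjective_of_hasPrescribedValues {φ : Racah →ₐ[ℂ] algR S}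
    (hφ : HasPrescribedValues S φ) : Function.Surjective φ := by
  rw [← AlgHom.range_eq_top]
  exact subalgebra_eq_top_of_mem S ⟨_, hφ.1⟩ ⟨_, hφ.2.1⟩ ⟨_, hφ.2.2⟩

end Homomorphism

/-! ### Elimination of `C` and affine changes of operators -/

section Modules

variable {S : Type*} [Fintype S] [DecidableEq S]

variable {V : Type*} [AddCommGroup V] [Module ℂ V]

lemma IsRacahTriple.map {E F : Type*} [Ring E] [Algebra ℂ E] [Ring F] [Algebra ℂ F] (ρ : E →ₐ[ℂ] F)
    {A B C : E} (h : IsRacahTriple A B C) : IsRacahTriple (ρ A) (ρ B) (ρ C) :=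
  ⟨by simpa using congrArg ρ h.comm_eq, by simpa using congrArg ρ h.double_comm⟩

lemma IsRacahTriple.quadraticRelation {A B C : Module.End ℂ V} {δ : ℂ}
    (h : IsRacahTriple A B C) (hδ : A + B + C = algebraMap ℂ _ δ) :
    QuadraticRelation A B δ := by
  intro v
  have hC : C v = δ • v - A v - B v := by
    have := LinearMap.congr_fun hδ v
    simp only [LinearMap.add_apply, Module.algebraMap_end_apply] at this
    rw [← this]; abel
  have e := LinearMap.congr_fun h.double_comm v
  simp only [LinearMap.sub_apply, LinearMap.smul_apply, Module.End.mul_apply, map_sub, hC,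
    map_smul] at e
  linear_combination (norm := module) e

lemma IsRacahTriple.quadraticRelation_symm {A B C : Module.End ℂ V} {δ : ℂ}
    (hABC : IsRacahTriple A B C) (h : IsRacahTriple B C A) (hδ : A + B + C = algebraMap ℂ _ δ) :
    QuadraticRelation B A δ := by
  intro v
  have hC (v : V) : C v = δ • v - A v - B v := by
    have := LinearMap.congr_fun hδ v
    simp only [LinearMap.add_apply, Module.algebraMap_end_apply] at this
    rw [← this]; abel
  have e := h.double_comm
  rw [← hABC.comm_eq] at e
  have e := LinearMap.congr_fun e v
  simp only [LinearMap.sub_apply, LinearMap.smul_apply, Module.End.mul_apply, map_sub, hC] at e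
  linear_combination (norm := module) -e

lemma IsIrreduciblePair.of_scalar_sum {A B C : Module.End ℂ V} {δ : ℂ}
    (h : ∀ U : Submodule ℂ V, (∀ u ∈ U, A u ∈ U) → (∀ u ∈ U, B u ∈ U) → (∀ u ∈ U, C u ∈ U) →
      U = ⊥ ∨ U = ⊤)
    (hδ : A + B + C = algebraMap ℂ _ δ) : IsIrreduciblePair A B := by
  intro U hA hB
  refine h U hA hB fun u hu => ?_
  have e : C u = δ • u - A u - B u := by
    have := LinearMap.congr_fun hδ u
    simp only [LinearMap.add_apply, Module.algebraMap_end_apply] at this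
    rw [← this]; abel
  rw [e]
  exact sub_mem (sub_mem (U.smul_mem _ hu) (hA u hu)) (hB u hu)

lemma IsIrredTridiagonal.of_eq_smul {n : ℕ} {M N : Matrix (Fin n) (Fin n) ℂ} {c : ℂ} (hc : c ≠ 0)
    (hM : IsIrredTridiagonal M) (h : ∀ i j, i ≠ j → N i j = c * M i j) :
    IsIrredTridiagonal N := by
  refine ⟨fun i j hij => ?_, fun i j hij => ?_⟩
  · by_cases e : i = j
    · subst e; omega
    · rw [h i j e] at hij
      exact hM.1 i j (right_ne_zero_of_mul hij)
  · have e : i ≠ j := by rintro rfl; omega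
    rw [h i j e, h j i e.symm]
    exact ⟨mul_ne_zero hc (hM.2 i j hij).1, mul_ne_zero hc (hM.2 i j hij).2⟩

lemma toMatrix_affine {n : ℕ} (b : Module.Basis (Fin n) ℂ V) (T : Module.End ℂ V) (c d : ℂ)
    {i j : Fin n} (hij : i ≠ j) :
    LinearMap.toMatrix b b (algebraMap ℂ _ c + d • T) i j = d * LinearMap.toMatrix b b T i j := by
  rw [map_add, map_smul, Matrix.add_apply, Matrix.smul_apply, smul_eq_mul,
    LinearMap.toMatrix_apply, Module.algebraMap_end_apply, map_smul, b.repr_self,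
    Finsupp.smul_apply, Finsupp.single_eq_of_ne hij, smul_zero, zero_add]

lemma DiagTridiagTridiag.affine {n : ℕ} {K L M : Module.End ℂ V} (h : DiagTridiagTridiag n K L M)
    (c : ℂ) {d : ℂ} (hd : d ≠ 0) :
    DiagTridiagTridiag n (algebraMap ℂ _ c + d • K : Module.End ℂ V)
      (algebraMap ℂ _ c + d • L : Module.End ℂ V) (algebraMap ℂ _ c + d • M : Module.End ℂ V) := by
  obtain ⟨b, hK, hL, hM⟩ := h
  refine ⟨b, fun i j hij => ?_, hL.of_eq_smul hd fun i j hij => toMatrix_affine b L c d hij,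
    hM.of_eq_smul hd fun i j hij => toMatrix_affine b M c d hij⟩
  have e : LinearMap.toMatrix b b K i j = 0 := hK hij
  exact (toMatrix_affine b K c d hij).trans (by rw [e, mul_zero])

end Modules

end HypercubeRacah

namespace HypercubeRacah

open Module.End

/-! ### Irreducible modules -/

section SimpleModule

variable {V : Type*} [AddCommGroup V] [Module ℂ V]

/-- No proper nonzero subspace is invariant under all of `A`, `B`, `C`. -/
def IsIrreducibleTriple (A B C : Module.End ℂ V) : Prop :=
  ∀ U : Submodule ℂ V, (∀ u ∈ U, A u ∈ U) → (∀ u ∈ U, B u ∈ U) → (∀ u ∈ U, C u ∈ U) →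
    U = ⊥ ∨ U = ⊤

lemma IsIrreducibleTriple.cycle {A B C : Module.End ℂ V} (h : IsIrreducibleTriple A B C) :
    IsIrreducibleTriple B C A :=
  fun U hB hC hA => h U hA hB hC

lemma IsRacahTriple.commute_sum {E : Type*} [Ring E] [Algebra ℂ E] {A B C : E}
    (hABC : IsRacahTriple A B C) (hBCA : IsRacahTriple B C A) :
    Commute (A + B + C) A := by
  have e := hABC.comm_eq.trans hBCA.comm_eq
  rw [sub_eq_sub_iff_add_eq_add] at e
  show (A + B + C) * A = A * (A + B + C)
  simp only [add_mul, mul_add, add_assoc]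
  rw [add_right_inj, e, add_comm]

/-- Schur's lemma: equality of the three commutators makes the sum commute with `A`, `B`, `C`, so an
eigenspace of it is invariant. -/
lemma exists_scalar_sum [FiniteDimensional ℂ V] [Nontrivial V] {A B C : Module.End ℂ V}
    (hirr : IsIrreducibleTriple A B C) (hABC : IsRacahTriple A B C) (hBCA : IsRacahTriple B C A)
    (hCAB : IsRacahTriple C A B) : ∃ δ : ℂ, A + B + C = algebraMap ℂ _ δ := by
  have hA : Commute (A + B + C) A := hABC.commute_sum hBCA
  have hB : Commute (A + B + C) B := by
    have := hBCA.commute_sum hCAB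
    rwa [show B + C + A = A + B + C by abel] at this
  have hC : Commute (A + B + C) C := by
    have := hCAB.commute_sum hABC
    rwa [show C + A + B = A + B + C by abel] at this
  obtain ⟨δ, hδ⟩ := exists_eigenvalue (A + B + C)
  have hinv {T : Module.End ℂ V} (hT : Commute (A + B + C) T) :
      ∀ u ∈ eigenspace (A + B + C) δ, T u ∈ eigenspace (A + B + C) δ := by
    intro u hu
    rw [mem_eigenspace_iff] at hu ⊢
    rw [← Module.End.mul_apply, hT.eq, Module.End.mul_apply, hu, map_smul]
  have htop := (hirr _ (hinv hA) (hinv hB) (hinv hC)).resolve_left (hasEigenvalue_iff.1 hδ)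
  refine ⟨δ, LinearMap.ext fun u => ?_⟩
  rw [Module.algebraMap_end_apply, ← mem_eigenspace_iff, htop]
  exact Submodule.mem_top

lemma diagTridiagTridiag_of_isRacahTriple [FiniteDimensional ℂ V] [Nontrivial V]
    {A B C : Module.End ℂ V} (hirr : IsIrreducibleTriple A B C) (hABC : IsRacahTriple A B C)
    (hBCA : IsRacahTriple B C A) (hCAB : IsRacahTriple C A B)
    (hA : ⨆ h : ℤ, eigenspace A (theta h) = ⊤) :
    DiagTridiagTridiag (Module.finrank ℂ V) A B C := by
  obtain ⟨δ, hδ⟩ := exists_scalar_sum hirr hABC hBCA hCAB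
  have hpair := IsIrreduciblePair.of_scalar_sum hirr hδ
  -- The roles of `A` and `B` are exchanged: here `A` is the diagonal operator.
  exact diagTridiagTridiag_of_relations (fun U hB hA => hpair U hA hB)
    (hABC.quadraticRelation_symm hBCA hδ) (hABC.quadraticRelation hδ) hA
    (by rw [← hδ, add_comm B A])

variable {S : Type*} [Fintype S] [DecidableEq S]

lemma finiteDimensional_of_isSimpleModule [Module (algR S) V] [IsScalarTower ℂ (algR S) V]
    [IsSimpleModule (algR S) V] : FiniteDimensional ℂ V := by
  have := IsSimpleModule.nontrivial (algR S) V
  obtain ⟨v, hv⟩ := exists_ne (0 : V)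
  exact Module.Finite.of_surjective ((LinearMap.toSpanSingleton (algR S) V v).restrictScalars ℂ)
    (IsSimpleModule.toSpanSingleton_surjective (algR S) hv)

/-- The stabilizer of `U` is a subalgebra containing generators of `𝐑`, so `U` is an `𝐑`-submodule.
-/
lemma isIrreducibleTriple_lsmul [Module (algR S) V] [IsScalarTower ℂ (algR S) V]
    [IsSimpleModule (algR S) V] :
    IsIrreducibleTriple (Algebra.lsmul ℂ ℂ V (racA S)) (Algebra.lsmul ℂ ℂ V (racB S))
      (Algebra.lsmul ℂ ℂ V (racC S)) := by
  intro U hA hB hC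
  let T : Subalgebra ℂ (algR S) :=
    { carrier := {r | ∀ u ∈ U, r • u ∈ U}
      mul_mem' := fun {r s} hr hs u hu => by rw [mul_smul]; exact hr _ (hs u hu)
      add_mem' := fun {r s} hr hs u hu => by rw [add_smul]; exact add_mem (hr u hu) (hs u hu)
      algebraMap_mem' := fun c u hu => by rw [algebraMap_smul]; exact U.smul_mem c hu }
  have hT : T = ⊤ := subalgebra_eq_top_of_mem S hA hB hC
  let U' : Submodule (algR S) V :=
    { U.toAddSubmonoid with
      smul_mem' := fun r u hu => (hT ▸ Algebra.mem_top : r ∈ T) u hu }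
  have hmem (u : V) : u ∈ U' ↔ u ∈ U := Iff.rfl
  have := (isSimpleModule_iff (algR S) V).1 inferInstance
  rcases eq_bot_or_eq_top U' with h | h
  · left
    ext u
    rw [← hmem, h, Submodule.mem_bot, Submodule.mem_bot]
  · right
    ext u
    rw [← hmem, h]
    exact ⟨fun _ => trivial, fun _ => trivial⟩

lemma iSup_eigenspace_lsmul [FiniteDimensional ℂ V] [Module (algR S) V]
    [IsScalarTower ℂ (algR S) V] {r : algR S} {t : Module.End ℂ (Finset S → ℂ)}
    (ht : ⨆ h : ℤ, eigenspace t (h : ℂ) = ⊤)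
    (hr : (r : Module.End ℂ (Finset S → ℂ)) = (1 / 16 : ℂ) • (t * t - algebraMap ℂ _ 4)) :
    ⨆ h : ℤ, eigenspace (Algebra.lsmul ℂ ℂ V r) (theta h) = ⊤ := by
  obtain ⟨F, hF, h0⟩ := exists_prod_X_sub_C_aeval_eq_zero (iSup_eigenspace_theta ht hr)
  refine iSup_eigenspace_of_aeval_eq_zero hF ?_
  have h1 : Polynomial.aeval r (∏ μ ∈ F, (Polynomial.X - Polynomial.C μ)) = 0 := by
    refine Subtype.ext ?_
    change (algR S).val _ = 0
    rw [← Polynomial.aeval_algHom_apply]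
    exact h0
  rw [Polynomial.aeval_algHom_apply, h1, map_zero]

lemma isLeonardTriple_of_affine {A B C L L' L'' : Module.End ℂ V} {n : ℕ} (hn : 0 < n)
    (hABC : DiagTridiagTridiag n A B C) (hBCA : DiagTridiagTridiag n B C A)
    (hCAB : DiagTridiagTridiag n C A B) {c d : ℂ} (hd : d ≠ 0)
    (hL : L = algebraMap ℂ (Module.End ℂ V) c + d • A)
    (hL' : L' = algebraMap ℂ (Module.End ℂ V) c + d • B)
    (hL'' : L'' = algebraMap ℂ (Module.End ℂ V) c + d • C) : IsLeonardTriple L L' L'' := by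
  subst hL hL' hL''
  exact ⟨n, hn, hABC.affine c hd, hBCA.affine c hd, hCAB.affine c hd⟩

variable (S V) in
theorem isLeonardTriple_lsmul [Module (algR S) V] [IsScalarTower ℂ (algR S) V]
    [IsSimpleModule (algR S) V] :
    IsLeonardTriple (Algebra.lsmul ℂ ℂ V (genJ S + genJbar S)) (Algebra.lsmul ℂ ℂ V (genStar S))
      (Algebra.lsmul ℂ ℂ V (genJ S - genJbar S)) := by
  have : Nontrivial V := IsSimpleModule.nontrivial (algR S) V
  have : FiniteDimensional ℂ V := finiteDimensional_of_isSimpleModule (S := S)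
  have hirr := isIrreducibleTriple_lsmul (S := S) (V := V)
  have hABC := (isRacahTriple_ABC S).map (Algebra.lsmul ℂ ℂ V)
  have hBCA := (isRacahTriple_BCA S).map (Algebra.lsmul ℂ ℂ V)
  have hCAB := (isRacahTriple_CAB S).map (Algebra.lsmul ℂ ℂ V)
  -- These constants invert the prescribed affine substitution, as in `J + J̄ = 8A + 2 - D/2`.
  refine isLeonardTriple_of_affine (c := 2 - (Fintype.card S : ℂ) / 2) (d := 8)
    (Module.finrank_pos (R := ℂ) (M := V))
    (diagTridiagTridiag_of_isRacahTriple hirr hABC hBCA hCAB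
      (iSup_eigenspace_lsmul iSup_eigenspace_totalX (coe_racA S)))
    (diagTridiagTridiag_of_isRacahTriple hirr.cycle hBCA hCAB hABC
      (iSup_eigenspace_lsmul iSup_eigenspace_totalZ (coe_racB S)))
    (diagTridiagTridiag_of_isRacahTriple hirr.cycle.cycle hCAB hABC hBCA
      (iSup_eigenspace_lsmul iSup_eigenspace_totalY (coe_racC S))) (by norm_num) ?_ ?_ ?_
  · rw [← AlgHom.commutes (Algebra.lsmul ℂ ℂ V : algR S →ₐ[ℂ] _), ← map_smul, ← map_add]
    congr 1
    simp only [racA, Algebra.algebraMap_eq_smul_one]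
    module
  · rw [← AlgHom.commutes (Algebra.lsmul ℂ ℂ V : algR S →ₐ[ℂ] _), ← map_smul, ← map_add]
    congr 1
    simp only [racB, Algebra.algebraMap_eq_smul_one]
    module
  · rw [← AlgHom.commutes (Algebra.lsmul ℂ ℂ V : algR S →ₐ[ℂ] _), ← map_smul, ← map_add]
    congr 1
    simp only [racC, Algebra.algebraMap_eq_smul_one]
    module

end SimpleModule

end HypercubeRacah

theorem theorem1p8 {S : Type*} [Fintype S] [DecidableEq S] (hD : 2 ≤ Fintype.card S) :
    ((∃! φ : HypercubeRacah.Racah →ₐ[ℂ] HypercubeRacah.algR S,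
        HypercubeRacah.HasPrescribedValues S φ) ∧
      (∀ φ : HypercubeRacah.Racah →ₐ[ℂ] HypercubeRacah.algR S,
        HypercubeRacah.HasPrescribedValues S φ → Function.Surjective φ)) ∧
    (∀ (V : Type*) [AddCommGroup V] [Module ℂ V] [Module (HypercubeRacah.algR S) V]
        [IsScalarTower ℂ (HypercubeRacah.algR S) V] [IsSimpleModule (HypercubeRacah.algR S) V],
      HypercubeRacah.IsLeonardTriple
        (Algebra.lsmul ℂ ℂ V (HypercubeRacah.genJ S + HypercubeRacah.genJbar S))
        (Algebra.lsmul ℂ ℂ V (HypercubeRacah.genStar S))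
        (Algebra.lsmul ℂ ℂ V (HypercubeRacah.genJ S - HypercubeRacah.genJbar S))) := by
  exact ⟨⟨⟨HypercubeRacah.racahHom S, HypercubeRacah.racahHom_hasPrescribedValues S,
      fun _ hψ => HypercubeRacah.hasPrescribedValues_unique S hψ
        (HypercubeRacah.racahHom_hasPrescribedValues S)⟩,
    fun _ hφ => HypercubeRacah.surjective_of_hasPrescribedValues S hφ⟩,
    fun V _ _ _ _ _ => HypercubeRacah.isLeonardTriple_lsmul V S⟩
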